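/- **Setting.** A *network* $\mathcal G=(V,A,\alpha)$ consists of a finite set $V$, a matrix $A:V^2\to[0,\infty)$ and a probability vector $\alpha$ on $V$ with $\alpha>0$. A *motif* on $[k]=\{1,\dots,k\}$ ($k\ge1$) is a matrix $A_F:[k]^2\to[0,\infty)$, written $F=([k],A_F)$; $H+F:=([k],A_H+A_F)$. With $0^0=1$ put $w_F(\mathbf x)=\prod_{i,j}A(\mathbf x(i),\mathbf x(j))^{A_F(i,j)}$ for $\mathbf x:[k]\to V$, and $$\mathtt t(F,\mathcal G)=\sum_{\mathbf x}w_F(\mathbf x)\prod_i\alpha(\mathbf x(i)),\qquad \pi_{F\to\mathcal G}(\mathbf x)=\frac{w_F(\mathbf x)\prod_i\alpha(\mathbf x(i))}{\mathtt t(F,\mathcal G)} .$$ A *homomorphism* $F\to\mathcal G$ is an $\mathbf x$ with $\pi_{F\to\mathcal G}(\mathbf x)>0$. The observables are $\mathtt t(H,\mathcal G|F)=\mathtt t(H+F,\mathcal G)/\mathtt t(F,\mathcal G)$; $\mathtt f(H,\mathcal G|F)(s)=\pi_{F\to\mathcal G}\big(\min_{i,j}A(\mathbf x(i),\mathbf x(j))^{A_H(i,j)}\ge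 s\big)$ for $s\in[0,1]$; and the motif transform matrix $A^{F}(a,b)=\pi_{F\to\mathcal G}(\mathbf x(1)=a,\ \mathbf x(k)=b)$, $a,b\in V$ (taken to be $0$ if $\mathtt t(F,\mathcal G)=0$). $F$ is a *rooted tree motif* if $A_F(j,1)=0$ for all $j$, and for every $i\ge2$ there is exactly one $j=i^-$ with $A_F(j,i)>0$, and $i^-<i$. Let $\Psi(a,b)=\dfrac{\alpha(a)\max(A(a,b),A(b,a))\alpha(b)}{\sum_c\alpha(a)\max(A(a,c),A(c,a))\alpha(c)}$. $\mathcal G$ is *irreducible* if the random walk with kernel $\Psi$ visits, from any node, every node with positive probability. $\mathcal G$ is *bidirectional* if $A(a,b)>0\iff A(b,a)>0$. Its *skeleton* is the simple graph on $V$ in which $a\ne b$ are adjacent iff $\min(A(a,b),A(b,a))>0$. *Pivot chain* (for a rooted tree motif $F$, and $\mathcal G$ such that every $a\in V$ has some $b$ with $A(a,b)>0$): from $\mathbf x_t$ with $\mathbf x_t(1)=a$, propose $b$ with probability $\Psi(a,b)$; set $\mathbf x_{t+1}(1)=b$ with probability $\lambda=\frac{\pi^{(1)}(b)\Psi(b,a)}{\pi^{(1)}(a)\Psi(a,b)}\wedge1$,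 and $\mathbf x_{t+1}(1)=a$ otherwise, where $\pi^{(1)}$ is the law of $\mathbf x(1)$ under $\pi_{F\to\mathcal G}$. Then for $i=2,\dots,k$ in turn sample $\mathbf x_{t+1}(i)$ from the conditional law of $\mathbf x(i)$ under $\pi_{F\to\mathcal G}$ given $\mathbf x(1)=\mathbf x_{t+1}(1),\dots,\mathbf x(i-1)=\mathbf x_{t+1}(i-1)$. *Glauber chain*: choose $i\in[k]$ uniformly, keep $\mathbf x_{t+1}(j)=\mathbf x_t(j)$ for $j\ne i$, and set $\mathbf x_{t+1}(i)=b$ with probability proportional to $\Big(\prod_{j\ne i}A(\mathbf x_t(j),b)^{A_F(j,i)}A(b,\mathbf x_t(j))^{A_F(i,j)}\Big)A(b,b)^{A_F(i,i)}\alpha(b)$. **Statement.** Let $F$ be a rooted tree motif on $[k]$, $H$ any motif on $[k]$, $\mathcal G$ an irreducible network, and $\mathbf x_0:F\to\mathcal G$ any homomorphism. Suppose that every node $a$ of $\mathcal G$ has some $b$ with $A(a,b)>0$, and let $(\mathbf x_t)_{t\ge0}$ be the pivot chain started at $\mathbf x_0$. Then, almost surely, $$\mathtt t(H,\mathcal G|F)=\lim_{N\to\infty}\frac1N\sum_{t=1}^N\prod_{i,j}A(\mathbf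 x_t(i),\mathbf x_t(j))^{A_H(i,j)},$$ $$\mathtt f(H,\mathcal G|F)(s)=\lim_{N\to\infty}\frac1N\sum_{t=1}^N\prod_{i,j}\mathbf 1\big(A(\mathbf x_t(i),\mathbf x_t(j))^{A_H(i,j)}\ge s\big)\quad\text{for all }s\in[0,1],$$ $$\mathtt t(H,\mathcal G|F)\,A^{H+F}=\lim_{N\to\infty}\frac1N\sum_{t=1}^N\Big(\prod_{i,j}A(\mathbf x_t(i),\mathbf x_t(j))^{A_H(i,j)}\Big)E_{\mathbf x_t(1),\mathbf x_t(k)},$$ where $E_{a,b}$ is the $V\times V$ matrix with a single $1$ at $(a,b)$ and zeros elsewhere. If instead $\mathcal G$ is bidirectional and its skeleton contains an odd cycle, the same three limits hold almost surely for the Glauber chain started at $\mathbf x_0$. -/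

import Mathlib

open MeasureTheory Filter Topology

noncomputable section

namespace MotifSampling

/-- A network `(V, A, α)`: nonnegative edge weights `A` and a fully supported probability
vector `α` on the finite node set `V`. -/
structure Network (V : Type*) [Fintype V] where
  A : V → V → ℝ
  α : V → ℝ
  A_nonneg : ∀ a b, 0 ≤ A a b
  α_pos : ∀ a, 0 < α a
  α_sum : ∑ a, α a = 1

/-- A motif with `k = m + 1` nodes. The nodes `1, …, k` are the elements `0, …, m` of
`Fin (m + 1)`; in particular node `1` is `0` and node `k` is `Fin.last m`. -/
structure Motif (m : ℕ) where
  A : Fin (m + 1) → Fin (m + 1) → ℝ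
  A_nonneg : ∀ i j, 0 ≤ A i j

/-- The motif `H + F` on the same node set, with the edge weights added. -/
instance (m : ℕ) : Add (Motif m) where
  add H F := ⟨fun i j => H.A i j + F.A i j, fun i j => add_nonneg (H.A_nonneg i j) (F.A_nonneg i j)⟩

/-- `F` is an edge-weighted directed tree rooted at the first node, without loops: nothing points
to the root, and every other node `i` has exactly one in-neighbour (its parent), which moreover
precedes `i` in the ordering of the nodes. -/
def Motif.IsRootedTree {m : ℕ} (F : Motif m) : Prop :=
  (∀ j, F.A j 0 = 0) ∧
    ∀ i, i ≠ 0 → ∃ j, j < i ∧ 0 < F.A j i ∧ ∀ j', 0 < F.A j' i → j' = j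

section

variable {V : Type*} [Fintype V] {m : ℕ}

/-- `∏_{i,j} A(x(i), x(j)) ^ A_H(i,j)`, with `0 ^ 0 = 1`. -/
def edgeProd (H : Motif m) (G : Network V) (x : Fin (m + 1) → V) : ℝ :=
  ∏ i, ∏ j, G.A (x i) (x j) ^ H.A i j

/-- The homomorphism density `t(F, G)`. -/
def homDensity (F : Motif m) (G : Network V) : ℝ :=
  ∑ x : Fin (m + 1) → V, edgeProd F G x * ∏ i, G.α (x i)

/-- The probability `π_{F → G}(x)`. -/
def homProb (F : Motif m) (G : Network V) (x : Fin (m + 1) → V) : ℝ :=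
  (edgeProd F G x * ∏ i, G.α (x i)) / homDensity F G

/-- A vertex map is a homomorphism `F → G` if `π_{F → G}` charges it. -/
def IsHom (F : Motif m) (G : Network V) (x : Fin (m + 1) → V) : Prop :=
  0 < homProb F G x

/-- The probability of the event `E` under `π_{F → G}`. -/
def homProbOf (F : Motif m) (G : Network V) (E : Set (Fin (m + 1) → V)) : ℝ :=
  ∑ x : Fin (m + 1) → V, E.indicator (homProb F G) x

/-- The conditional homomorphism density `t(H, G | F)` (zero if `t(F, G) = 0`). -/
def condHomDensity (H : Motif m) (G : Network V) (F : Motif m) : ℝ :=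
  homDensity (H + F) G / homDensity F G

/-- The CHD profile `f(H, G | F)`. -/
def chdProfile (H : Motif m) (G : Network V) (F : Motif m) (t : ℝ) : ℝ :=
  homProbOf F G {x | t ≤ Finset.univ.inf' Finset.univ_nonempty
    (fun p : Fin (m + 1) × Fin (m + 1) => G.A (x p.1) (x p.2) ^ H.A p.1 p.2)}

/-- The matrix `A^F` of the motif transform of `G` by `F`: the joint law of the images of the
first and the last node under a random homomorphism `F → G`. -/
def motifTransform (F : Motif m) (G : Network V) : Matrix V V ℝ :=
  Matrix.of fun a b => homProbOf F G {x | x 0 = a ∧ x (Fin.last m) = b}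

/-- The random walk kernel `Ψ` on the network. -/
def walkKernel (G : Network V) (a b : V) : ℝ :=
  (G.α a * max (G.A a b) (G.A b a) * G.α b) /
    ∑ c, G.α a * max (G.A a c) (G.A c a) * G.α c

/-- The random walk with kernel `Ψ`, started anywhere, visits every node with positive
probability. -/
def Network.IsIrreducible [DecidableEq V] (G : Network V) : Prop :=
  ∀ a b, ∃ r : ℕ, 0 < (Matrix.of (walkKernel G) ^ r) a b

/-- Every node has an out-edge. -/
def Network.HasOutEdges (G : Network V) : Prop :=
  ∀ a, ∃ b, 0 < G.A a b

def Network.IsBidirectional (G : Network V) : Prop :=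
  ∀ a b, 0 < G.A a b ↔ 0 < G.A b a

/-- The skeleton: the simple graph in which distinct `a`, `b` are adjacent when
`min (A a b) (A b a) > 0`. -/
def Network.skeleton (G : Network V) : SimpleGraph V where
  Adj a b := a ≠ b ∧ 0 < min (G.A a b) (G.A b a)
  symm := ⟨fun a b h => ⟨h.1.symm, by rw [min_comm]; exact h.2⟩⟩
  loopless := ⟨fun _ h => h.1 rfl⟩

/-- The law `π⁽¹⁾` of the image of the root (the pivot) under `π_{F → G}`. -/
def pivotMarginal (F : Motif m) (G : Network V) (a : V) : ℝ :=
  homProbOf F G {x | x 0 = a}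

/-- The probability `λ` of accepting the proposed move `a ↦ b` of the pivot. -/
def acceptProb (F : Motif m) (G : Network V) (a b : V) : ℝ :=
  min (pivotMarginal F G b / pivotMarginal F G a * (walkKernel G b a / walkKernel G a b)) 1

/-- The kernel of the pivot: a move proposed by `Ψ` is accepted with probability `λ`, and the
pivot stays where it is upon rejection. -/
def pivotMove [DecidableEq V] (F : Motif m) (G : Network V) (a b : V) : ℝ :=
  walkKernel G a b * acceptProb F G a b +
    if b = a then ∑ c, walkKernel G a c * (1 - acceptProb F G a c) else 0

/-- The conditional probability, under `π_{F → G}`, that node `i` is sent to `y i`, given that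
every earlier node `j < i` is sent to `y j`. -/
def nextNodeProb (F : Motif m) (G : Network V) (i : Fin (m + 1)) (y : Fin (m + 1) → V) : ℝ :=
  homProbOf F G {z | ∀ j ≤ i, z j = y j} / homProbOf F G {z | ∀ j < i, z j = y j}

/-- The pivot chain: first the pivot moves, then the other nodes are resampled one by one, each
from its conditional law under `π_{F → G}` given the nodes that are already placed. -/
def pivotKernel [DecidableEq V] (F : Motif m) (G : Network V) (x y : Fin (m + 1) → V) : ℝ :=
  pivotMove F G (x 0) (y 0) * ∏ i ∈ Finset.univ.erase 0, nextNodeProb F G i y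

/-- The unnormalised weight with which node `i` is sent to `b` in an update of node `i`. -/
def glauberWeight (F : Motif m) (G : Network V) (x : Fin (m + 1) → V) (i : Fin (m + 1))
    (b : V) : ℝ :=
  (∏ j ∈ Finset.univ.erase i, G.A (x j) b ^ F.A j i * G.A b (x j) ^ F.A i j) *
    G.A b b ^ F.A i i * G.α b

/-- The Glauber chain: a uniformly chosen node `i` is resampled with probabilities proportional
to `glauberWeight`, the other nodes stay. -/
def glauberKernel [DecidableEq V] (F : Motif m) (G : Network V) (x y : Fin (m + 1) → V) : ℝ :=
  ∑ i, (1 / ((m : ℝ) + 1)) *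
    if ∀ j, j ≠ i → y j = x j then
      glauberWeight F G x i (y i) / ∑ c, glauberWeight F G x i c
    else 0

end

/-- `X` is a Markov chain on the finite set `S` with transition probabilities `K`, started at
`x₀`, given through its finite-dimensional distributions. -/
structure IsMarkovChain {S Ω : Type*} [MeasurableSpace Ω] (μ : Measure Ω) (K : S → S → ℝ)
    (x₀ : S) (X : ℕ → Ω → S) : Prop where
  measurableSet_eq : ∀ t s, MeasurableSet {ω | X t ω = s}
  law : ∀ (T : ℕ) (y : ℕ → S), y 0 = x₀ →
    μ.real {ω | ∀ t ≤ T, X t ω = y t} = ∏ t ∈ Finset.range T, K (y t) (y (t + 1))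

/-- Along the trajectory `x`, the three time averages converge to the three observables. -/
def TimeAveragesConverge {V : Type*} [Fintype V] [DecidableEq V] {m : ℕ} (F H : Motif m)
    (G : Network V) (x : ℕ → Fin (m + 1) → V) : Prop :=
  Tendsto (fun N : ℕ => (1 / (N : ℝ)) * ∑ t ∈ Finset.Icc 1 N, edgeProd H G (x t))
      atTop (𝓝 (condHomDensity H G F)) ∧
  (∀ s ∈ Set.Icc (0 : ℝ) 1,
    Tendsto (fun N : ℕ => (1 / (N : ℝ)) * ∑ t ∈ Finset.Icc 1 N,
        ∏ i, ∏ j, if s ≤ G.A (x t i) (x t j) ^ H.A i j then (1 : ℝ) else 0)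
      atTop (𝓝 (chdProfile H G F s))) ∧
  Tendsto (fun N : ℕ => (1 / (N : ℝ)) • ∑ t ∈ Finset.Icc 1 N,
        edgeProd H G (x t) • Matrix.single (x t 0) (x t (Fin.last m)) (1 : ℝ))
      atTop (𝓝 (condHomDensity H G F • motifTransform (H + F) G))

end MotifSampling

end

open MotifSampling

/-!
Each chain is reversible, or lifted from a reversible chain, with stationary law `π_{F → G}`, and
connects any two homomorphisms; the observables are averages over this law.

The conditional laws with which the pivot chain places the nodes telescope to
`π_{F → G}(x) / π⁽¹⁾(x(1))`, so the chain is the lift of the Metropolis–Hastings chain of its pivot.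
The Glauber chain is a heat bath for `π_{F → G}`. To move a node `i` to `c` one site at a time, one
first sends the children of `i` to a common neighbour of the old image of `i` and of `c`, which
recursively requires moving their own children. Every change at the root is a composition of moves
between nodes with a common neighbour, because the skeleton is connected and has an odd cycle.

For the strong law, the solution of the Poisson equation `g - K g = f - π f` turns the sums of
`f - π f` into sums of bounded orthogonal increments, up to bounded terms. The averages of the
latter tend to zero along the squares, since their second moments are summable there, and
monotonicity fills the gaps between the squares.
-/

namespace MotifSampling

section OrthogonalVariables

variable {Ω : Type*} [MeasurableSpace Ω] {μ : Measure Ω}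

theorem integral_sq_sum_of_orthogonal {ι : Type*} {D : ι → Ω → ℝ}
    (hD : ∀ i, MemLp (D i) 2 μ) (horth : Pairwise fun i j => ∫ ω, D i ω * D j ω ∂μ = 0)
    (s : Finset ι) : ∫ ω, (∑ i ∈ s, D i ω) ^ 2 ∂μ = ∑ i ∈ s, ∫ ω, D i ω ^ 2 ∂μ := by
  have hint : ∀ i j, Integrable (fun ω => D i ω * D j ω) μ := fun i j =>
    (hD i).integrable_mul (hD j)
  simp only [sq, Finset.sum_mul_sum]
  rw [integral_finsetSum _ fun i _ => integrable_finsetSum _ fun j _ => hint i j]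
  refine Finset.sum_congr rfl fun i hi => ?_
  rw [integral_finsetSum _ fun j _ => hint i j]
  exact Finset.sum_eq_single_of_mem i hi fun j _ hji => horth hji.symm

theorem ae_tendsto_zero_of_summable_integral_norm {E : Type*} [NormedAddCommGroup E]
    {Z : ℕ → Ω → E} (hZ : ∀ n, Integrable (Z n) μ) (hsum : Summable fun n => ∫ ω, ‖Z n ω‖ ∂μ) :
    ∀ᵐ ω ∂μ, Tendsto (fun n => Z n ω) atTop (𝓝 0) := by
  have hfin : ∑' n, eLpNorm (Z n) 1 μ ≠ ⊤ := by
    simp only [eLpNorm_one_eq_lintegral_enorm, ← ofReal_integral_norm_eq_lintegral_enorm (hZ _)]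
    exact hsum.tsum_ofReal_ne_top
  filter_upwards [summable_norm_of_tsum_eLpNorm_ne_top le_rfl (fun n => (hZ n).1) hfin] with ω hω
  exact tendsto_zero_iff_norm_tendsto_zero.2 hω.tendsto_atTop_zero

/-- Along the squares, the second moments of the averages are summable. -/
theorem ae_tendsto_sum_range_sq_div_sq_of_orthogonal {D : ℕ → Ω → ℝ}
    (hD : ∀ t, MemLp (D t) 2 μ) (horth : Pairwise fun s t => ∫ ω, D s ω * D t ω ∂μ = 0)
    {B : ℝ} (hB : ∀ t, ∫ ω, D t ω ^ 2 ∂μ ≤ B) :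
    ∀ᵐ ω ∂μ, Tendsto (fun n : ℕ => (∑ t ∈ Finset.range (n ^ 2), D t ω) / (n ^ 2 : ℕ))
      atTop (𝓝 0) := by
  set Z : ℕ → Ω → ℝ := fun n ω => ((∑ t ∈ Finset.range (n ^ 2), D t ω) / (n ^ 2 : ℕ)) ^ 2
  have hZ : ∀ n, Integrable (Z n) μ := fun n => by
    simpa only [Z, div_eq_mul_inv] using
      ((memLp_finsetSum _ fun t _ => hD t).mul_const _).integrable_sq
  have hle : ∀ n, ∫ ω, ‖Z n ω‖ ∂μ ≤ B * (1 / (n : ℝ) ^ 2) := fun n => by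
    simp only [Z, Real.norm_of_nonneg (sq_nonneg _)]
    simp only [div_pow]
    rw [integral_div, integral_sq_sum_of_orthogonal hD horth]
    rcases n.eq_zero_or_pos with rfl | hn
    · simp
    calc _ ≤ (n ^ 2 : ℕ) * B / ((n ^ 2 : ℕ) : ℝ) ^ 2 := by
          gcongr
          simpa only [Finset.card_range, nsmul_eq_mul] using
            Finset.sum_le_card_nsmul (Finset.range (n ^ 2)) _ B fun t _ => hB t
      _ = B * (1 / (n : ℝ) ^ 2) := by push_cast; field_simp
  have hsum : Summable fun n => ∫ ω, ‖Z n ω‖ ∂μ :=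
    ((Real.summable_one_div_nat_pow.2 one_lt_two).mul_left B).of_nonneg_of_le
      (fun n => integral_nonneg fun ω => norm_nonneg _) hle
  filter_upwards [ae_tendsto_zero_of_summable_integral_norm hZ hsum] with ω hω
  refine (tendsto_zero_iff_abs_tendsto_zero _).2 ?_
  simpa only [Z, Real.sqrt_sq_eq_abs, Real.sqrt_zero, Function.comp_def] using hω.sqrt

theorem tendsto_sum_range_div_of_tendsto_sq {d : ℕ → ℝ} {C : ℝ} (hC : ∀ t, -C ≤ d t)
    (hd : Tendsto (fun n : ℕ => (∑ t ∈ Finset.range (n ^ 2), d t) / (n ^ 2 : ℕ)) atTop (𝓝 0)) :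
    Tendsto (fun N : ℕ => (∑ t ∈ Finset.range N, d t) / N) atTop (𝓝 0) := by
  have hsq : Tendsto (fun n : ℕ => n ^ 2) atTop atTop := tendsto_pow_atTop two_ne_zero
  have heq : ∀ N : ℕ, N ≠ 0 → (∑ t ∈ Finset.range N, (d t + C)) / N
      = (∑ t ∈ Finset.range N, d t) / N + C := fun N hN => by
    rw [Finset.sum_add_distrib, Finset.sum_const, Finset.card_range, nsmul_eq_mul]
    field_simp
  have hmono : Monotone fun N : ℕ => ∑ t ∈ Finset.range N, (d t + C) :=
    monotone_nat_of_le_succ fun N => by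
      rw [Finset.sum_range_succ]
      linarith [hC N]
  have hlim := tendsto_div_of_monotone_of_exists_subseq_tendsto_div _ C hmono fun a ha =>
    ⟨fun n => n ^ 2, ?_, hsq, ?_⟩
  · simpa using (hlim.congr' ((eventually_ne_atTop 0).mono heq)).sub_const C
  · have hratio : Tendsto (fun n : ℕ => (1 + 1 / (n : ℝ)) ^ 2) atTop (𝓝 ((1 + 0) ^ 2)) :=
      (tendsto_one_div_atTop_nhds_zero_nat.const_add 1).pow 2
    filter_upwards [hratio.eventually_le_const (by simpa using ha), eventually_ne_atTop 0]
      with n hn hn0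
    calc (((n + 1) ^ 2 : ℕ) : ℝ) = (1 + 1 / (n : ℝ)) ^ 2 * (n ^ 2 : ℕ) := by
          push_cast; field_simp
      _ ≤ a * (n ^ 2 : ℕ) := by gcongr
  · have := hd.add_const C
    rw [zero_add] at this
    exact this.congr' ((hsq.eventually_ne_atTop 0).mono fun n hn => (heq _ hn).symm)

theorem ae_tendsto_average_zero_of_orthogonal {D : ℕ → Ω → ℝ}
    (hD : ∀ t, MemLp (D t) 2 μ) (horth : Pairwise fun s t => ∫ ω, D s ω * D t ω ∂μ = 0)
    {B : ℝ} (hB : ∀ t, ∫ ω, D t ω ^ 2 ∂μ ≤ B) {C : ℝ} (hC : ∀ᵐ ω ∂μ, ∀ t, -C ≤ D t ω) :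
    ∀ᵐ ω ∂μ, Tendsto (fun N : ℕ => (∑ t ∈ Finset.range N, D t ω) / N) atTop (𝓝 0) := by
  filter_upwards [hC, ae_tendsto_sum_range_sq_div_sq_of_orthogonal hD horth hB] with ω hCω hω
  exact tendsto_sum_range_div_of_tendsto_sq hCω hω

end OrthogonalVariables

/-- The trajectory of the process `X` up to time `n`, as a random element of `Fin (n + 1) → S`. -/
def pathUpTo {S Ω : Type*} (X : ℕ → Ω → S) (n : ℕ) (ω : Ω) : Fin (n + 1) → S := fun i => X i ω

namespace IsMarkovChain

open Matrix

variable {S Ω : Type*} [MeasurableSpace Ω] {μ : Measure Ω} {K : Matrix S S ℝ} {x₀ : S}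
  {X : ℕ → Ω → S}

theorem ae_zero [IsProbabilityMeasure μ] (hX : IsMarkovChain μ K x₀ X) : ∀ᵐ ω ∂μ, X 0 ω = x₀ := by
  have hlaw := hX.law 0 (fun _ => x₀) rfl
  simp only [Nat.le_zero, forall_eq, Finset.range_zero, Finset.prod_empty] at hlaw
  rw [measureReal_def, ENNReal.toReal_eq_one_iff] at hlaw
  exact (prob_compl_eq_zero_iff (hX.measurableSet_eq 0 x₀)).2 hlaw

theorem measureReal_pathUpTo (hX : IsMarkovChain μ K x₀ X) {n : ℕ} {p : Fin (n + 1) → S}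
    (hp : p 0 = x₀) :
    μ.real (pathUpTo X n ⁻¹' {p}) = ∏ i : Fin n, K (p i.castSucc) (p i.succ) := by
  have hset : pathUpTo X n ⁻¹' {p} = {ω | ∀ t ≤ n, X t ω = p (Fin.ofNat (n + 1) t)} := by
    ext ω
    rw [Set.mem_preimage, Set.mem_singleton_iff, funext_iff, Fin.forall_iff]
    refine forall_congr' fun t =>
      (forall_congr' fun ht => ?_).trans (imp_congr_left Nat.lt_succ_iff)
    rw [pathUpTo, show Fin.ofNat (n + 1) t = ⟨t, ht⟩ from Fin.ext (Nat.mod_eq_of_lt ht)]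
  rw [hset, hX.law n _ hp, Finset.prod_range]
  refine Finset.prod_congr rfl fun i _ => ?_
  congr 2 <;> ext <;> simp [Nat.mod_eq_of_lt]

theorem measureReal_pathUpTo_eq_zero [IsProbabilityMeasure μ] (hX : IsMarkovChain μ K x₀ X)
    {n : ℕ} {p : Fin (n + 1) → S} (hp : p 0 ≠ x₀) : μ.real (pathUpTo X n ⁻¹' {p}) = 0 := by
  rw [measureReal_def, measure_eq_zero_iff_ae_notMem.2, ENNReal.toReal_zero]
  filter_upwards [hX.ae_zero] with ω hω hmem
  exact hp ((congrFun hmem 0).symm.trans hω)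

theorem measureReal_pathUpTo_succ [IsProbabilityMeasure μ] (hX : IsMarkovChain μ K x₀ X) (n : ℕ)
    (p : Fin (n + 1) → S) (s : S) :
    μ.real (pathUpTo X (n + 1) ⁻¹' {Fin.snoc (α := fun _ => S) p s})
      = μ.real (pathUpTo X n ⁻¹' {p}) * K (p (Fin.last n)) s := by
  have h0 : Fin.snoc (α := fun _ => S) p s 0 = p 0 := Fin.snoc_castSucc (i := 0) ..
  by_cases hp : p 0 = x₀
  · rw [hX.measureReal_pathUpTo (h0.trans hp), hX.measureReal_pathUpTo hp, Fin.prod_univ_castSucc]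
    simp only [← Fin.castSucc_succ, Fin.snoc_castSucc, Fin.succ_last, Fin.snoc_last]
  · rw [hX.measureReal_pathUpTo_eq_zero (h0.trans_ne hp), hX.measureReal_pathUpTo_eq_zero hp,
      zero_mul]

theorem measurable_comp_pathUpTo [Finite S] {β : Type*} [MeasurableSpace β]
    (hX : IsMarkovChain μ K x₀ X) {n : ℕ} (Φ : (Fin (n + 1) → S) → β) :
    Measurable fun ω => Φ (pathUpTo X n ω) := by
  let _ : MeasurableSpace S := ⊤
  have hmeas : ∀ t, Measurable (X t) := fun t =>
    measurable_to_countable' fun s => hX.measurableSet_eq t s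
  exact (measurable_of_finite Φ).comp (measurable_pi_lambda _ fun i => hmeas i)

theorem memLp_comp_pathUpTo [Finite S] [IsFiniteMeasure μ] (hX : IsMarkovChain μ K x₀ X) {n : ℕ}
    (Φ : (Fin (n + 1) → S) → ℝ) (p : ENNReal) : MemLp (fun ω => Φ (pathUpTo X n ω)) p μ := by
  obtain ⟨C, hC⟩ := Finite.exists_le fun q => ‖Φ q‖
  exact MemLp.of_bound (hX.measurable_comp_pathUpTo Φ).aestronglyMeasurable C
    (ae_of_all _ fun ω => hC _)

theorem integral_comp_pathUpTo [Fintype S] [IsFiniteMeasure μ] (hX : IsMarkovChain μ K x₀ X)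
    {n : ℕ} (Φ : (Fin (n + 1) → S) → ℝ) :
    ∫ ω, Φ (pathUpTo X n ω) ∂μ = ∑ p, μ.real (pathUpTo X n ⁻¹' {p}) * Φ p := by
  let _ : MeasurableSpace S := ⊤
  have hmeas : Measurable (pathUpTo X n) := hX.measurable_comp_pathUpTo id
  rw [← integral_map hmeas.aemeasurable (measurable_of_finite Φ).aestronglyMeasurable,
    integral_fintype .of_finite]
  simp only [map_measureReal_apply hmeas (measurableSet_singleton _), smul_eq_mul]

theorem integral_comp_pathUpTo_succ [Fintype S] [IsProbabilityMeasure μ]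
    (hX : IsMarkovChain μ K x₀ X) {n : ℕ} (Φ : (Fin (n + 1) → S) → S → ℝ) :
    ∫ ω, Φ (pathUpTo X n ω) (X (n + 1) ω) ∂μ
      = ∑ p, μ.real (pathUpTo X n ⁻¹' {p}) * ∑ s, K (p (Fin.last n)) s * Φ p s := by
  calc _ = ∑ q, μ.real (pathUpTo X (n + 1) ⁻¹' {q}) * Φ (Fin.init q) (q (Fin.last (n + 1))) :=
        hX.integral_comp_pathUpTo fun q => Φ (Fin.init q) (q (Fin.last (n + 1)))
    _ = ∑ z : S × (Fin (n + 1) → S), μ.real (pathUpTo X n ⁻¹' {z.2}) * K (z.2 (Fin.last n)) z.1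
          * Φ z.2 z.1 := by
        rw [← (Fin.snocEquiv fun _ => S).sum_comp]
        refine Finset.sum_congr rfl fun z _ => ?_
        change μ.real (pathUpTo X (n + 1) ⁻¹' {Fin.snoc (α := fun _ => S) z.2 z.1})
          * Φ (Fin.init (Fin.snoc (α := fun _ => S) z.2 z.1))
            (Fin.snoc (α := fun _ => S) z.2 z.1 (Fin.last _)) = _
        rw [hX.measureReal_pathUpTo_succ, Fin.init_snoc, Fin.snoc_last]
    _ = _ := by
        rw [Fintype.sum_prod_type_right]
        simp only [Finset.mul_sum, mul_assoc]

theorem integral_pathUpTo_mul [Fintype S] [IsProbabilityMeasure μ] (hX : IsMarkovChain μ K x₀ X)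
    {n : ℕ} (Φ : (Fin (n + 1) → S) → ℝ) (g : S → ℝ) :
    ∫ ω, Φ (pathUpTo X n ω) * g (X (n + 1) ω) ∂μ
      = ∫ ω, Φ (pathUpTo X n ω) * (K *ᵥ g) (X n ω) ∂μ := by
  rw [hX.integral_comp_pathUpTo_succ fun p s => Φ p * g s]
  refine Eq.trans (Finset.sum_congr rfl fun p _ => ?_)
    (hX.integral_comp_pathUpTo fun p => Φ p * (K *ᵥ g) (p (Fin.last n))).symm
  simp only [mulVec, dotProduct, Finset.mul_sum, mul_left_comm]

theorem ae_kernel_ne_zero [Finite S] [IsProbabilityMeasure μ] (hX : IsMarkovChain μ K x₀ X) :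
    ∀ᵐ ω ∂μ, ∀ t, K (X t ω) (X (t + 1) ω) ≠ 0 := by
  refine ae_all_iff.2 fun t => ?_
  have hnull : ∀ᵐ ω ∂μ, ∀ (p : Fin (t + 1) → S) (s : S), K (p (Fin.last t)) s = 0 →
      pathUpTo X (t + 1) ω ≠ Fin.snoc (α := fun _ => S) p s := by
    simp only [ae_all_iff, eventually_imp_distrib_left]
    intro p s hK
    have hzero := hX.measureReal_pathUpTo_succ t p s
    rw [hK, mul_zero, measureReal_eq_zero_iff] at hzero
    exact measure_eq_zero_iff_ae_notMem.1 hzero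
  filter_upwards [hnull] with ω hω hK
  exact hω (pathUpTo X t ω) (X (t + 1) ω) hK (Fin.snoc_init_self (pathUpTo X (t + 1) ω)).symm

theorem integral_increment_mul_increment [Fintype S] [IsProbabilityMeasure μ]
    (hX : IsMarkovChain μ K x₀ X) (g : S → ℝ) :
    Pairwise fun s t => ∫ ω, (g (X (s + 1) ω) - (K *ᵥ g) (X s ω))
      * (g (X (t + 1) ω) - (K *ᵥ g) (X t ω)) ∂μ = 0 := by
  have : Std.Symm fun s t => ∫ ω, (g (X (s + 1) ω) - (K *ᵥ g) (X s ω))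
      * (g (X (t + 1) ω) - (K *ᵥ g) (X t ω)) ∂μ = 0 :=
    ⟨fun s t h => by simpa only [mul_comm] using h⟩
  refine Pairwise.of_lt fun s t hst => ?_
  let Φ : (Fin (t + 1) → S) → ℝ := fun p =>
    g (p ⟨s + 1, Nat.succ_lt_succ hst⟩) - (K *ᵥ g) (p ⟨s, hst.trans t.lt_succ_self⟩)
  have hint := fun Ψ : (Fin (t + 2) → S) → ℝ =>
    memLp_one_iff_integrable.1 (hX.memLp_comp_pathUpTo Ψ 1)
  simp only [mul_sub]
  exact (integral_sub (hint fun p => Φ (Fin.init p) * g (p (Fin.last _)))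
    (hint fun p => Φ (Fin.init p) * (K *ᵥ g) (p (Fin.last t).castSucc))).trans
    (sub_eq_zero.2 (hX.integral_pathUpTo_mul Φ g))

theorem ae_tendsto_average_increment [Fintype S] [IsProbabilityMeasure μ]
    (hX : IsMarkovChain μ K x₀ X) (g : S → ℝ) :
    ∀ᵐ ω ∂μ, Tendsto
      (fun N : ℕ => (∑ t ∈ Finset.range N, (g (X (t + 1) ω) - (K *ᵥ g) (X t ω))) / N)
      atTop (𝓝 0) := by
  obtain ⟨C, hC⟩ := Finite.exists_le fun p : S × S => |g p.2 - (K *ᵥ g) p.1|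
  have hmem : ∀ t, MemLp (fun ω => g (X (t + 1) ω) - (K *ᵥ g) (X t ω)) 2 μ := fun t =>
    hX.memLp_comp_pathUpTo (n := t + 1)
      (fun p => g (p (Fin.last _)) - (K *ᵥ g) (p (Fin.last t).castSucc)) 2
  refine ae_tendsto_average_zero_of_orthogonal hmem (hX.integral_increment_mul_increment g)
    (B := C ^ 2) (fun t => ?_)
    (ae_of_all _ fun ω t => neg_le_of_abs_le (hC (X t ω, X (t + 1) ω)))
  calc _ ≤ ∫ _, C ^ 2 ∂μ := integral_mono (hmem t).integrable_sq (integrable_const _) fun ω =>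
        sq_le_sq.2 ((hC (X t ω, X (t + 1) ω)).trans (le_abs_self C))
    _ = C ^ 2 := by simp

end IsMarkovChain

section Poisson

open Matrix

theorem exists_sub_mulVec_eq_sub_dotProduct {S R : Type*} [Fintype S] [Field R] {K : Matrix S S R}
    {π : S → R} (hone : π ⬝ᵥ 1 = 1) (hstat : π ᵥ* K = π)
    (hker : ∀ g, K *ᵥ g = g → π ⬝ᵥ g = 0 → g = 0) (f : S → R) :
    ∃ g : S → R, ∀ x, g x - (K *ᵥ g) x = f x - π ⬝ᵥ f := by
  classical
  let M : Matrix S S R := 1 - K + replicateRow S π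
  have hM : ∀ g, M *ᵥ g = g - K *ᵥ g + (π ⬝ᵥ g) • 1 := fun g => by
    simp only [M, add_mulVec, sub_mulVec, one_mulVec, add_right_inj]
    exact funext fun x => (mul_one _).symm
  have hπM : ∀ g, π ⬝ᵥ M *ᵥ g = π ⬝ᵥ g := fun g => by
    rw [hM, dotProduct_add, dotProduct_sub, dotProduct_mulVec, hstat, dotProduct_smul, hone,
      smul_eq_mul, mul_one, sub_self, zero_add]
  have hinj : Function.Injective M.mulVec := by
    refine (injective_iff_map_eq_zero M.mulVecLin).2 fun g hg => ?_
    have hπg : π ⬝ᵥ g = 0 := by rw [← hπM, ← mulVecLin_apply, hg, dotProduct_zero]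
    rw [mulVecLin_apply, hM, hπg, zero_smul, add_zero, sub_eq_zero] at hg
    exact hker g hg.symm hπg
  obtain ⟨g, rfl⟩ := mulVec_surjective_iff_isUnit.2 (mulVec_injective_iff_isUnit.1 hinj) f
  exact ⟨g, fun x => by rw [hπM, hM]; simp⟩

end Poisson

section ErgodicKernel

open Matrix Relation

/-- The kernel `K` is stochastic on the support of the probability vector `π`, has `π` as a
stationary law, and connects any two points of the support. Nothing is asked of the rows of `K`
outside the support, which a chain started in the support never uses. -/
structure IsErgodicKernel {S : Type*} [Fintype S] (K : Matrix S S ℝ) (π : S → ℝ) : Prop where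
  mem_stdSimplex : π ∈ stdSimplex ℝ S
  kernel_nonneg : ∀ x y, 0 < π x → 0 ≤ K x y
  row_sum : ∀ x, 0 < π x → ∑ y, K x y = 1
  stationary : π ᵥ* K = π
  connected : ∀ x y, 0 < π x → 0 < π y → ReflTransGen (fun a b => 0 < K a b) x y

namespace IsErgodicKernel

variable {S : Type*} [Fintype S] {K K' : Matrix S S ℝ} {π : S → ℝ}

theorem nonneg (h : IsErgodicKernel K π) (x : S) : 0 ≤ π x := h.mem_stdSimplex.1 x

theorem sum_eq_one (h : IsErgodicKernel K π) : ∑ x, π x = 1 := h.mem_stdSimplex.2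

theorem eq_zero_of_not_pos (h : IsErgodicKernel K π) {x : S} (hx : ¬ 0 < π x) : π x = 0 :=
  (h.nonneg x).antisymm' (not_lt.1 hx)

theorem of_detailedBalance (hπ : π ∈ stdSimplex ℝ S) (hK : ∀ x y, 0 < π x → 0 ≤ K x y)
    (hrow : ∀ x, 0 < π x → ∑ y, K x y = 1) (hbal : ∀ x y, π x * K x y = π y * K y x)
    (hconn : ∀ x y, 0 < π x → 0 < π y → ReflTransGen (fun a b => 0 < K a b) x y) :
    IsErgodicKernel K π where
  mem_stdSimplex := hπ
  kernel_nonneg := hK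
  row_sum := hrow
  stationary := by
    ext y
    calc ∑ x, π x * K x y = π y * ∑ x, K y x := by
          rw [Finset.mul_sum]
          exact Finset.sum_congr rfl fun x _ => hbal x y
      _ = π y := by
          rcases (hπ.1 y).eq_or_lt with hy | hy
          · rw [← hy, zero_mul]
          · rw [hrow y hy, mul_one]
  connected := hconn

theorem pos_of_kernel_ne_zero (h : IsErgodicKernel K π) {x y : S} (hx : 0 < π x)
    (hxy : K x y ≠ 0) : 0 < π y := by
  have hterm : ∀ z, 0 ≤ π z * K z y := fun z => by
    rcases (h.nonneg z).eq_or_lt with hz | hz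
    · rw [← hz, zero_mul]
    · exact mul_nonneg hz.le (h.kernel_nonneg z y hz)
  calc 0 < π x * K x y := (hterm x).lt_of_ne' (mul_ne_zero hx.ne' hxy)
    _ ≤ ∑ z, π z * K z y := Finset.single_le_sum (fun z _ => hterm z) (Finset.mem_univ x)
    _ = π y := congrFun h.stationary y

theorem transGen (h : IsErgodicKernel K π) {x y : S} (hx : 0 < π x) (hy : 0 < π y) :
    TransGen (fun a b => 0 < K a b) x y := by
  obtain ⟨z, -, hz⟩ : ∃ z ∈ Finset.univ, 0 < K x z :=
    Finset.exists_lt_of_sum_lt (by simp [h.row_sum x hx])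
  exact .trans_left (.single hz) (h.connected z y (h.pos_of_kernel_ne_zero hx hz.ne') hy)

theorem congr (h : IsErgodicKernel K π) (hKK' : ∀ x, 0 < π x → K' x = K x) :
    IsErgodicKernel K' π where
  mem_stdSimplex := h.mem_stdSimplex
  kernel_nonneg x y hx := by rw [hKK' x hx]; exact h.kernel_nonneg x y hx
  row_sum x hx := by rw [hKK' x hx]; exact h.row_sum x hx
  stationary := by
    refine Eq.trans (funext fun y => Finset.sum_congr rfl fun x _ => ?_) h.stationary
    by_cases hx : 0 < π x
    · exact congrArg (fun row : S → ℝ => π x * row y) (hKK' x hx)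
    · rw [h.eq_zero_of_not_pos hx, zero_mul, zero_mul]
  connected x y hx hy := by
    suffices hpath : ∀ z, ReflTransGen (fun a b => 0 < K a b) x z →
        0 < π z ∧ ReflTransGen (fun a b => 0 < K' a b) x z from
      (hpath y (h.connected x y hx hy)).2
    intro z hz
    induction hz with
    | refl => exact ⟨hx, .refl⟩
    | tail _ hstep ih =>
      exact ⟨h.pos_of_kernel_ne_zero ih.1 hstep.ne', ih.2.tail (by rwa [hKK' _ ih.1])⟩

/-- The maximum principle: a point where `g` is maximal on the support passes its value on to the
points that can be reached from it. -/
theorem eq_of_harmonic (h : IsErgodicKernel K π) {g : S → ℝ}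
    (hg : ∀ x, 0 < π x → (K *ᵥ g) x = g x) {x y : S} (hx : 0 < π x) (hy : 0 < π y) :
    g x = g y := by
  classical
  obtain ⟨z, hz, hmax⟩ := Finset.exists_max_image {x | 0 < π x} g ⟨x, by simpa using hx⟩
  simp only [Finset.mem_filter, Finset.mem_univ, true_and] at hz hmax
  suffices hreach : ∀ w, ReflTransGen (fun a b => 0 < K a b) z w → 0 < π w ∧ g w = g z by
    rw [(hreach x (h.connected z x hz hx)).2, (hreach y (h.connected z y hz hy)).2]
  intro w hzw
  induction hzw with
  | refl => exact ⟨hz, rfl⟩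
  | @tail b c _ hbc ih =>
    obtain ⟨hb, hgb⟩ := ih
    have hdrop : ∑ y, K b y * (g z - g y) = 0 := by
      simp only [mul_sub, Finset.sum_sub_distrib]
      rw [← Finset.sum_mul, h.row_sum b hb, one_mul, ← hgb, sub_eq_zero]
      exact (hg b hb).symm
    have hterm : ∀ y, 0 ≤ K b y * (g z - g y) := fun y => by
      by_cases hby : K b y = 0
      · rw [hby, zero_mul]
      · exact mul_nonneg (h.kernel_nonneg b y hb)
          (sub_nonneg.2 (hmax y (h.pos_of_kernel_ne_zero hb hby)))
    have hc := (Finset.sum_eq_zero_iff_of_nonneg fun y _ => hterm y).1 hdrop c (Finset.mem_univ c)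
    exact ⟨h.pos_of_kernel_ne_zero hb hbc.ne',
      (sub_eq_zero.1 ((mul_eq_zero_iff_left hbc.ne').1 hc)).symm⟩

theorem exists_poisson (h : IsErgodicKernel K π) (f : S → ℝ) :
    ∃ g : S → ℝ, ∀ x, 0 < π x → g x - (K *ᵥ g) x = f x - π ⬝ᵥ f := by
  classical
  let K' : Matrix S S ℝ := fun x => if 0 < π x then K x else π
  have hK' : ∀ x, 0 < π x → K' x = K x := fun x hx => if_pos hx
  have h' : IsErgodicKernel K' π := h.congr hK'
  have hker : ∀ g, K' *ᵥ g = g → π ⬝ᵥ g = 0 → g = 0 := fun g hharm hmean => by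
    funext x
    by_cases hx : 0 < π x
    · calc g x = ∑ y, π y * g x := by rw [← Finset.sum_mul, h.sum_eq_one, one_mul]
        _ = ∑ y, π y * g y := Finset.sum_congr rfl fun y _ => by
            by_cases hy : 0 < π y
            · rw [h'.eq_of_harmonic (fun x _ => congrFun hharm x) hx hy]
            · rw [h.eq_zero_of_not_pos hy, zero_mul, zero_mul]
        _ = 0 := hmean
    · calc g x = (K' *ᵥ g) x := (congrFun hharm x).symm
        _ = π ⬝ᵥ g := by rw [mulVec, show K' x = π from if_neg hx]
        _ = 0 := hmean
  obtain ⟨g, hg⟩ := exists_sub_mulVec_eq_sub_dotProduct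
    (by rw [dotProduct_one, h.sum_eq_one]) h'.stationary hker f
  refine ⟨g, fun x hx => ?_⟩
  rw [← hg x, mulVec, mulVec, hK' x hx]

end IsErgodicKernel

end ErgodicKernel

namespace IsMarkovChain

open Matrix

variable {S Ω : Type*} [Fintype S] [MeasurableSpace Ω] {μ : Measure Ω} [IsProbabilityMeasure μ]
  {K : Matrix S S ℝ} {π : S → ℝ} {x₀ : S} {X : ℕ → Ω → S}

theorem ae_forall_pos (hX : IsMarkovChain μ K x₀ X) (h : IsErgodicKernel K π) (hx₀ : 0 < π x₀) :
    ∀ᵐ ω ∂μ, ∀ t, 0 < π (X t ω) := by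
  filter_upwards [hX.ae_zero, hX.ae_kernel_ne_zero] with ω hzero hstep t
  induction t with
  | zero => rwa [hzero]
  | succ t ih => exact h.pos_of_kernel_ne_zero ih (hstep t)

/-- Up to boundary terms, the solution of the Poisson equation turns the centred time averages of
`f` into averages of martingale increments. -/
theorem ae_tendsto_average (hX : IsMarkovChain μ K x₀ X) (h : IsErgodicKernel K π)
    (hx₀ : 0 < π x₀) (f : S → ℝ) :
    ∀ᵐ ω ∂μ, Tendsto (fun N : ℕ => (1 / (N : ℝ)) * ∑ t ∈ Finset.Icc 1 N, f (X t ω))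
      atTop (𝓝 (π ⬝ᵥ f)) := by
  obtain ⟨g, hg⟩ := h.exists_poisson f
  obtain ⟨B, hB⟩ := Finite.exists_le fun x => |(K *ᵥ g) x|
  filter_upwards [hX.ae_forall_pos h hx₀, hX.ae_tendsto_average_increment g] with ω hpos hmart
  have hdecomp : ∀ N : ℕ, ∑ t ∈ Finset.Icc 1 N, f (X t ω) = N * (π ⬝ᵥ f)
      + ∑ t ∈ Finset.range N, (g (X (t + 1) ω) - (K *ᵥ g) (X t ω))
      + ((K *ᵥ g) (X 0 ω) - (K *ᵥ g) (X N ω)) := fun N => by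
    induction N with
    | zero => simp
    | succ N ih =>
      rw [Finset.sum_Icc_succ_top (by simp), Finset.sum_range_succ, ih]
      push_cast
      linarith [hg _ (hpos (N + 1))]
  have hboundary : Tendsto (fun N : ℕ => ((K *ᵥ g) (X 0 ω) - (K *ᵥ g) (X N ω)) / (N : ℝ))
      atTop (𝓝 0) := by
    refine tendsto_bdd_div_atTop_nhds_zero (b := -(B + B)) (B := B + B) ?_ ?_
      tendsto_natCast_atTop_atTop
    all_goals
      refine Eventually.of_forall fun N => ?_
      linarith [abs_le.1 (hB (X 0 ω)), abs_le.1 (hB (X N ω))]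
  have hlim := (hmart.add hboundary).const_add (π ⬝ᵥ f)
  rw [add_zero, add_zero] at hlim
  refine hlim.congr' ((eventually_ne_atTop 0).mono fun N hN => ?_)
  simp only [hdecomp]
  field_simp
  ring

theorem ae_forall_tendsto_average (hX : IsMarkovChain μ K x₀ X) (h : IsErgodicKernel K π)
    (hx₀ : 0 < π x₀) :
    ∀ᵐ ω ∂μ, ∀ f : S → ℝ,
      Tendsto (fun N : ℕ => (1 / (N : ℝ)) * ∑ t ∈ Finset.Icc 1 N, f (X t ω))
        atTop (𝓝 (π ⬝ᵥ f)) := by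
  classical
  filter_upwards [ae_all_iff.2 fun s : S => hX.ae_tendsto_average h hx₀ (Pi.single s 1)]
    with ω hω f
  have hlim := tendsto_finsetSum Finset.univ fun s _ => (hω s).mul_const (f s)
  simp only [dotProduct_single_one] at hlim
  refine hlim.congr fun N => ?_
  simp only [mul_assoc, ← Finset.mul_sum, Finset.sum_mul]
  rw [Finset.sum_comm]
  simp [Pi.single_apply]

end IsMarkovChain

section Metropolis

open Relation

variable {S : Type*} {Q : Matrix S S ℝ} {ν : S → ℝ}

/-- The probability with which the Metropolis–Hastings chain with target law `ν` accepts a move from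
`a` to `b` proposed by `Q`. -/
noncomputable def metropolisAccept (Q : Matrix S S ℝ) (ν : S → ℝ) (a b : S) : ℝ :=
  min (ν b / ν a * (Q b a / Q a b)) 1

theorem metropolisAccept_nonneg (hQ : ∀ a b, 0 ≤ Q a b) (hν : ∀ a, 0 ≤ ν a) (a b : S) :
    0 ≤ metropolisAccept Q ν a b :=
  le_min (mul_nonneg (div_nonneg (hν b) (hν a)) (div_nonneg (hQ b a) (hQ a b))) zero_le_one

theorem mul_mul_metropolisAccept (hQ : ∀ a b, 0 ≤ Q a b) (hν : ∀ a, 0 < ν a) (a b : S) :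
    ν a * (Q a b * metropolisAccept Q ν a b) = min (ν b * Q b a) (ν a * Q a b) := by
  rcases (hQ a b).eq_or_lt with h | h
  · rw [← h, zero_mul, mul_zero, min_eq_right (mul_nonneg (hν b).le (hQ b a))]
  · have ha := hν a
    rw [metropolisAccept, ← mul_assoc, mul_min_of_nonneg _ _ (by positivity), mul_one]
    congr 1
    field_simp

variable [Fintype S] [DecidableEq S]

/-- The Metropolis–Hastings kernel with proposals `Q` and target law `ν`: rejected moves leave the
chain where it is. -/
noncomputable def metropolisKernel (Q : Matrix S S ℝ) (ν : S → ℝ) : Matrix S S ℝ := fun a b =>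
  Q a b * metropolisAccept Q ν a b +
    if b = a then ∑ c, Q a c * (1 - metropolisAccept Q ν a c) else 0

theorem mul_metropolisAccept_le_metropolisKernel (hQ : ∀ a b, 0 ≤ Q a b) (a b : S) :
    Q a b * metropolisAccept Q ν a b ≤ metropolisKernel Q ν a b := by
  refine le_add_of_nonneg_right ?_
  split_ifs
  · exact Finset.sum_nonneg fun c _ => mul_nonneg (hQ a c) (sub_nonneg.2 (min_le_right _ _))
  · exact le_rfl

theorem sum_metropolisKernel (Q : Matrix S S ℝ) (ν : S → ℝ) (a : S) :
    ∑ b, metropolisKernel Q ν a b = ∑ b, Q a b := by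
  simp only [metropolisKernel, Finset.sum_add_distrib, Finset.sum_ite_eq', Finset.mem_univ,
    if_true]
  rw [← Finset.sum_add_distrib]
  exact Finset.sum_congr rfl fun c _ => by ring

theorem metropolisKernel_detailedBalance (hQ : ∀ a b, 0 ≤ Q a b) (hν : ∀ a, 0 < ν a) (a b : S) :
    ν a * metropolisKernel Q ν a b = ν b * metropolisKernel Q ν b a := by
  rcases eq_or_ne b a with rfl | hab
  · rfl
  · simp only [metropolisKernel, if_neg hab, if_neg hab.symm, add_zero]
    rw [mul_mul_metropolisAccept hQ hν, mul_mul_metropolisAccept hQ hν, min_comm]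

theorem metropolisKernel_pos (hQ : ∀ a b, 0 ≤ Q a b) (hν : ∀ a, 0 < ν a) {a b : S}
    (hab : 0 < Q a b) (hba : 0 < Q b a) : 0 < metropolisKernel Q ν a b := by
  refine lt_of_lt_of_le (mul_pos hab (lt_min ?_ one_pos))
    (mul_metropolisAccept_le_metropolisKernel hQ a b)
  exact mul_pos (div_pos (hν b) (hν a)) (div_pos hba hab)

theorem isErgodicKernel_metropolisKernel (hQ : ∀ a b, 0 ≤ Q a b) (hrow : ∀ a, ∑ b, Q a b = 1)
    (hsymm : ∀ a b, 0 < Q a b → 0 < Q b a)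
    (hconn : ∀ a b, ReflTransGen (fun a b => 0 < Q a b) a b) (hν : ∀ a, 0 < ν a)
    (hsum : ∑ a, ν a = 1) : IsErgodicKernel (metropolisKernel Q ν) ν :=
  .of_detailedBalance ⟨fun a => (hν a).le, hsum⟩
    (fun a b _ => (mul_nonneg (hQ a b) (metropolisAccept_nonneg hQ (fun c => (hν c).le) a b)).trans
      (mul_metropolisAccept_le_metropolisKernel hQ a b))
    (fun a _ => (sum_metropolisKernel Q ν a).trans (hrow a))
    (metropolisKernel_detailedBalance hQ hν)
    (fun a b _ _ => ReflTransGen.mono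
      (fun c d hcd => metropolisKernel_pos hQ hν hcd (hsymm c d hcd)) a b (hconn a b))

end Metropolis

section Lift

open Matrix Relation

variable {S T : Type*} [Fintype S] [DecidableEq T] {M : Matrix T T ℝ} {ν : T → ℝ}
  {π : S → ℝ} {r : S → T}

/-- The lift of the kernel `M` along `r : S → T`: after a step of `M`, a point over the new position
is drawn from the conditional law of `π` on the fibre of `r`, where `ν` is the image of `π`. -/
noncomputable def liftKernel (M : Matrix T T ℝ) (ν : T → ℝ) (r : S → T) (π : S → ℝ) :
    Matrix S S ℝ := fun x y =>
  M (r x) (r y) * (π y / ν (r y))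

theorem le_of_sum_fiber_eq (hπ : ∀ x, 0 ≤ π x) (hν : ∀ v, ∑ x with r x = v, π x = ν v) (x : S) :
    π x ≤ ν (r x) := by
  rw [← hν]
  exact Finset.single_le_sum (fun z _ => hπ z) (by simp)

theorem sum_mul_div_of_sum_fiber_eq [Fintype T] (hν : ∀ v, ∑ x with r x = v, π x = ν v)
    {g : T → ℝ} (hg : ∀ v, ν v = 0 → g v = 0) : ∑ y, g (r y) * (π y / ν (r y)) = ∑ v, g v := by
  rw [← Finset.sum_fiberwise _ r]
  refine Finset.sum_congr rfl fun v _ => ?_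
  calc ∑ y with r y = v, g (r y) * (π y / ν (r y))
      = ∑ y with r y = v, g v / ν v * π y := Finset.sum_congr rfl fun y hy => by
        rw [(Finset.mem_filter.1 hy).2]
        ring
    _ = g v := by
        rw [← Finset.mul_sum, hν]
        rcases eq_or_ne (ν v) 0 with h0 | h0
        · rw [h0, hg v h0, mul_zero]
        · rw [div_mul_cancel₀ _ h0]

theorem vecMul_liftKernel [Fintype T] (hν : ∀ v, ∑ x with r x = v, π x = ν v) (y : S) :
    (π ᵥ* liftKernel M ν r π) y = (ν ᵥ* M) (r y) * (π y / ν (r y)) :=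
  calc ∑ x, π x * (M (r x) (r y) * (π y / ν (r y)))
      = (∑ v, ∑ x with r x = v, π x * M (r x) (r y)) * (π y / ν (r y)) := by
        rw [Finset.sum_fiberwise, Finset.sum_mul]
        exact Finset.sum_congr rfl fun x _ => (mul_assoc _ _ _).symm
    _ = (ν ᵥ* M) (r y) * (π y / ν (r y)) := by
        congr 1
        refine Finset.sum_congr rfl fun v _ => ?_
        rw [← hν, Finset.sum_mul]
        exact Finset.sum_congr rfl fun x hx => by rw [(Finset.mem_filter.1 hx).2]

theorem IsErgodicKernel.reflTransGen_liftKernel [Fintype T] (h : IsErgodicKernel M ν)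
    (hπ : ∀ x, 0 ≤ π x) (hν : ∀ v, ∑ x with r x = v, π x = ν v) {x y : S} (hx : 0 < π x)
    (hy : 0 < π y) : ReflTransGen (fun a b => 0 < liftKernel M ν r π a b) x y := by
  have hpos : ∀ {z}, 0 < π z → 0 < ν (r z) := fun hz => hz.trans_le (le_of_sum_fiber_eq hπ hν _)
  have hstep : ∀ {z w}, 0 < M (r z) (r w) → 0 < π w → 0 < liftKernel M ν r π z w :=
    fun hzw hw => mul_pos hzw (div_pos hw (hpos hw))
  suffices hpath : ∀ v, TransGen (fun a b => 0 < M a b) (r x) v → 0 < ν v ∧ ∀ z, r z = v →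
      0 < π z → ReflTransGen (fun a b => 0 < liftKernel M ν r π a b) x z from
    (hpath (r y) (h.transGen (hpos hx) (hpos hy))).2 y rfl hy
  intro v hv
  induction hv with
  | single hv =>
    refine ⟨h.pos_of_kernel_ne_zero (hpos hx) hv.ne', ?_⟩
    rintro z rfl hz
    exact .single (hstep hv hz)
  | @tail b v _ hbv ih =>
    obtain ⟨hb, ih⟩ := ih
    refine ⟨h.pos_of_kernel_ne_zero hb hbv.ne', ?_⟩
    rintro z rfl hz
    obtain ⟨w, hw, hπw⟩ : ∃ w ∈ Finset.univ.filter (r · = b), 0 < π w :=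
      Finset.exists_lt_of_sum_lt (by simpa [hν] using hb)
    obtain rfl := (Finset.mem_filter.1 hw).2
    exact (ih w rfl hπw).tail (hstep hbv hz)

theorem IsErgodicKernel.liftKernel [Fintype T] (h : IsErgodicKernel M ν) (hπ : ∀ x, 0 ≤ π x)
    (hν : ∀ v, ∑ x with r x = v, π x = ν v) : IsErgodicKernel (liftKernel M ν r π) π where
  mem_stdSimplex := ⟨hπ, by rw [← Finset.sum_fiberwise _ r]; simp only [hν, h.sum_eq_one]⟩
  kernel_nonneg x y hx :=
    mul_nonneg (h.kernel_nonneg _ _ (hx.trans_le (le_of_sum_fiber_eq hπ hν x)))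
      (div_nonneg (hπ y) (h.nonneg _))
  row_sum x hx := by
    have hνx := hx.trans_le (le_of_sum_fiber_eq hπ hν x)
    refine (sum_mul_div_of_sum_fiber_eq hν (g := M (r x)) fun v hv => ?_).trans (h.row_sum _ hνx)
    by_contra hne
    exact (h.pos_of_kernel_ne_zero hνx hne).ne' hv
  stationary := by
    ext y
    rw [vecMul_liftKernel hν, h.stationary]
    rcases (hπ y).eq_or_lt with h0 | h0
    · rw [← h0, zero_div, mul_zero]
    · exact mul_div_cancel₀ _ (h0.trans_le (le_of_sum_fiber_eq hπ hν y)).ne'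
  connected _ _ hx hy := h.reflTransGen_liftKernel hπ hν hx hy

end Lift

section HeatBath

open Matrix Relation

variable {ι V : Type*} [DecidableEq ι] [Fintype V] {w : (ι → V) → ℝ}

theorem sum_update_pos (hw : ∀ x, 0 ≤ w x) {x : ι → V} (hx : 0 < w x) (i : ι) :
    0 < ∑ c, w (Function.update x i c) :=
  Finset.sum_pos' (fun _ _ => hw _) ⟨x i, Finset.mem_univ _, by rwa [Function.update_eq_self]⟩

variable [Fintype ι] [DecidableEq V]

/-- The heat bath (Glauber) kernel with target weights `w`: a uniformly chosen coordinate is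
resampled with probabilities proportional to `w`. -/
noncomputable def heatBathKernel (w : (ι → V) → ℝ) : Matrix (ι → V) (ι → V) ℝ := fun x y =>
  ∑ i, (1 / (Fintype.card ι : ℝ)) *
    if ∀ j, j ≠ i → y j = x j then w y / ∑ c, w (Function.update x i c) else 0

theorem heatBathKernel_detailedBalance (w : (ι → V) → ℝ) (x y : ι → V) :
    w x * heatBathKernel w x y = w y * heatBathKernel w y x := by
  simp only [heatBathKernel, Finset.mul_sum]
  refine Finset.sum_congr rfl fun i _ => ?_
  by_cases h : ∀ j, j ≠ i → y j = x j
  · have hupdate : Function.update y i = Function.update x i := by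
      ext c j
      rcases eq_or_ne j i with rfl | hj
      · simp only [Function.update_self]
      · simp only [Function.update_of_ne hj, h j hj]
    rw [if_pos h, if_pos fun j hj => (h j hj).symm, hupdate]
    ring
  · rw [if_neg h, if_neg fun h' => h fun j hj => (h' j hj).symm]
    simp only [mul_zero]

theorem heatBathKernel_summand_nonneg (hw : ∀ x, 0 ≤ w x) (x y : ι → V) (i : ι) :
    0 ≤ (1 / (Fintype.card ι : ℝ)) *
      if ∀ j, j ≠ i → y j = x j then w y / ∑ c, w (Function.update x i c) else 0 := by
  refine mul_nonneg (by positivity) ?_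
  split_ifs
  · exact div_nonneg (hw y) (Finset.sum_nonneg fun c _ => hw _)
  · exact le_rfl

theorem heatBathKernel_pos (hw : ∀ x, 0 ≤ w x) {x y : ι → V} (hx : 0 < w x) (hy : 0 < w y) {i : ι}
    (hxy : ∀ j, j ≠ i → y j = x j) : 0 < heatBathKernel w x y := by
  have : Nonempty ι := ⟨i⟩
  refine Finset.sum_pos' (fun i _ => heatBathKernel_summand_nonneg hw x y i)
    ⟨i, Finset.mem_univ i, ?_⟩
  rw [if_pos hxy]
  exact mul_pos (by positivity) (div_pos hy (sum_update_pos hw hx i))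

theorem sum_ite_forall_ne_eq (x : ι → V) (i : ι) (f : (ι → V) → ℝ) :
    (∑ y, if ∀ j, j ≠ i → y j = x j then f y else 0) = ∑ c, f (Function.update x i c) := by
  rw [← Finset.sum_filter]
  refine (Finset.sum_bij (fun c _ => Function.update x i c) (fun c _ => ?_)
    (fun a _ b _ hab => Function.update_injective x i hab) (fun y hy => ?_) fun _ _ => rfl).symm
  · simp +contextual [Function.update_of_ne]
  · refine ⟨y i, Finset.mem_univ _, ?_⟩
    simp only [Finset.mem_filter, Finset.mem_univ, true_and] at hy
    exact (Function.eq_update_iff.2 ⟨rfl, hy⟩).symm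

theorem sum_heatBathKernel [Nonempty ι] (hw : ∀ x, 0 ≤ w x) {x : ι → V} (hx : 0 < w x) :
    ∑ y, heatBathKernel w x y = 1 := by
  simp only [heatBathKernel]
  rw [Finset.sum_comm]
  simp only [← Finset.mul_sum, sum_ite_forall_ne_eq, ← Finset.sum_div,
    div_self (sum_update_pos hw hx _).ne', Finset.sum_const, Finset.card_univ, nsmul_eq_mul,
    mul_one, one_div]
  exact mul_inv_cancel₀ (Nat.cast_ne_zero.2 Fintype.card_ne_zero)

theorem isErgodicKernel_heatBathKernel [Nonempty ι] (hw : w ∈ stdSimplex ℝ (ι → V))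
    (hconn : ∀ x y, 0 < w x → 0 < w y →
      ReflTransGen (fun a b => 0 < w a ∧ 0 < w b ∧ ∃ i, ∀ j, j ≠ i → b j = a j) x y) :
    IsErgodicKernel (heatBathKernel w) w :=
  .of_detailedBalance hw
    (fun x y _ => Finset.sum_nonneg fun i _ => heatBathKernel_summand_nonneg hw.1 x y i)
    (fun _ => sum_heatBathKernel hw.1) (heatBathKernel_detailedBalance w)
    (fun x y hx hy => ReflTransGen.mono
      (fun _ _ ⟨ha, hb, _, hab⟩ => heatBathKernel_pos hw.1 ha hb hab) x y (hconn x y hx hy))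

end HeatBath

theorem reflTransGen_of_pow_pos {S R : Type*} [Fintype S] [DecidableEq S] [Ring R] [LinearOrder R]
    [IsOrderedRing R] [PosMulStrictMono R] [Nontrivial R] {Q : Matrix S S R}
    (hQ : ∀ a b, 0 ≤ Q a b) {a b : S} {n : ℕ} (h : 0 < (Q ^ n) a b) :
    Relation.ReflTransGen (fun a b => 0 < Q a b) a b := by
  let := Matrix.toQuiver Q
  obtain ⟨⟨p, -⟩⟩ := (Matrix.pow_apply_pos_iff_nonempty_path hQ n a b).1 h
  clear h
  induction p with
  | nil => exact .refl
  | cons _ e ih => exact ih.tail e.down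

theorem prod_range_div_eq_div {M : Type*} [CommGroupWithZero M] {q : ℕ → M} (h0 : q 0 ≠ 0)
    (hq : ∀ n, q n = 0 → q (n + 1) = 0) (n : ℕ) :
    ∏ i ∈ Finset.range n, q (i + 1) / q i = q n / q 0 := by
  refine Finset.prod_range_induction _ (fun k => q k / q 0) (div_self h0) n fun k _ => ?_
  rcases eq_or_ne (q k) 0 with h | h
  · rw [hq k h, h, zero_div, zero_div, zero_mul]
  · rw [mul_comm, div_mul_div_cancel₀ h]

section EvenWalks

open Relation SimpleGraph

variable {V : Type*} {Γ : SimpleGraph V}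

theorem exists_even_walk_of_odd_closed_walk (hΓ : Γ.Preconnected) {v : V} (c : Γ.Walk v v)
    (hc : Odd c.length) (a b : V) : ∃ p : Γ.Walk a b, Even p.length := by
  obtain ⟨p⟩ := hΓ a b
  obtain ⟨q⟩ := hΓ a v
  rcases Nat.even_or_odd p.length with hp | hp
  · exact ⟨p, hp⟩
  · refine ⟨(q.append c).append (q.reverse.append p), ?_⟩
    simp only [Walk.length_append, Walk.length_reverse]
    grind

theorem reflTransGen_two_step_of_even_walk {a b : V} :
    ∀ p : Γ.Walk a b, Even p.length → ReflTransGen (fun a c => ∃ b, Γ.Adj a b ∧ Γ.Adj b c) a b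
  | .nil, _ => .refl
  | .cons _ .nil, hp => absurd hp Nat.not_even_one
  | .cons h (.cons h' p), hp => .head ⟨_, h, h'⟩ <| reflTransGen_two_step_of_even_walk p <| by
      simpa only [Walk.length_cons, Nat.even_add_one, not_not] using hp

end EvenWalks

section Reconfiguration

open Relation

/-- An edge relation on an ordered type which points forward and gives every point at most one
in-neighbour. -/
structure IsForwardForest {ι : Type*} [LT ι] (P : ι → ι → Prop) : Prop where
  lt : ∀ ⦃i j⦄, P i j → i < j
  unique : ∀ ⦃i i' j⦄, P i j → P i' j → i = i'

/-- `x` maps the edges of `P` to edges of `R`. -/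
def PreservesEdges {ι V : Type*} (P : ι → ι → Prop) (R : V → V → Prop) (x : ι → V) : Prop :=
  ∀ ⦃i j⦄, P i j → R (x i) (x j)

/-- A move between edge-preserving maps that changes the image of at most one point. -/
def SingleSiteMove {ι V : Type*} (P : ι → ι → Prop) (R : V → V → Prop) (x y : ι → V) : Prop :=
  PreservesEdges P R x ∧ PreservesEdges P R y ∧ ∃ i, ∀ j, j ≠ i → y j = x j

namespace IsForwardForest

variable {ι V : Type*} [LinearOrder ι] {P : ι → ι → Prop} {R : V → V → Prop}

theorem preservesEdges_update (hP : IsForwardForest P) {x : ι → V} {i : ι} {c : V}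
    (hx : PreservesEdges P R x) (hin : ∀ j, P j i → R (x j) c) (hout : ∀ j, P i j → R c (x j)) :
    PreservesEdges P R (Function.update x i c) := by
  intro j k hjk
  rcases eq_or_ne k i with rfl | hk
  · rw [Function.update_self, Function.update_of_ne (hP.lt hjk).ne]
    exact hin j hjk
  · rw [Function.update_of_ne hk]
    rcases eq_or_ne j i with rfl | hj
    · rw [Function.update_self]
      exact hout k hjk
    · rw [Function.update_of_ne hj]
      exact hx hjk

theorem exists_preservesEdges [WellFoundedLT ι] (hP : IsForwardForest P) (hR : ∀ a, ∃ b, R a b)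
    (a : V) : ∃ x : ι → V, PreservesEdges P R x ∧ ∀ i, (∀ j, ¬ P j i) → x i = a := by
  classical
  choose out hout using hR
  let x : ι → V := WellFoundedLT.fix fun i x =>
    if h : ∃ j, P j i then out (x h.choose (hP.lt h.choose_spec)) else a
  have hx : ∀ i, x i = if h : ∃ j, P j i then out (x h.choose) else a := WellFoundedLT.fix_eq _
  refine ⟨x, fun i j hij => ?_, fun i hi => by rw [hx, dif_neg (not_exists.2 hi)]⟩
  have h : ∃ i, P i j := ⟨i, hij⟩
  rw [hx j, dif_pos h, hP.unique h.choose_spec hij]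
  exact hout _

variable [Finite ι]

/-- Before `i` moves to `c`, all of its children are sent to a common neighbour `e` of `x i` and
`c`. For a child the intermediate point is `x i`, so this is possible by recursion. -/
theorem exists_moves_of_common_neighbor (hP : IsForwardForest P)
    (hR : ∀ ⦃a b⦄, R a b → R b a) {x : ι → V} {i : ι} {c e : V} (hx : PreservesEdges P R x)
    (hin : ∀ j, P j i → R (x j) c) (hxe : R (x i) e) (hec : R e c) :
    ∃ z, ReflTransGen (SingleSiteMove P R) x z ∧ PreservesEdges P R z ∧ z i = c ∧
      ∀ j < i, z j = x j := by
  induction i using WellFoundedGT.induction generalizing x c e with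
  | _ i ih =>
  have hchildren : ∀ s : Finset ι, (∀ a ∈ s, P i a) → ∃ z, ReflTransGen (SingleSiteMove P R) x z ∧
      PreservesEdges P R z ∧ (∀ a ∈ s, z a = e) ∧ ∀ j ≤ i, z j = x j := fun s => by
    induction s using Finset.induction_on_max with
    | empty => exact fun _ => ⟨x, .refl, hx, by simp, fun _ _ => rfl⟩
    | insert a s hmax ihs =>
      intro hs
      simp only [Finset.forall_mem_insert] at hs ⊢
      obtain ⟨z, hxz, hz, hzs, hzi⟩ := ihs hs.2
      have hia := hP.lt hs.1
      have hzxi : R (z a) (x i) := hR (hzi i le_rfl ▸ hz hs.1)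
      obtain ⟨z', hzz', hz', hza, hlt⟩ := ih a hia hz
        (fun j hj => by rwa [hP.unique hj hs.1, hzi i le_rfl]) hzxi hxe
      exact ⟨z', hxz.trans hzz', hz', ⟨hza, fun b hb => (hlt b (hmax b hb)).trans (hzs b hb)⟩,
        fun j hj => (hlt j (hj.trans_lt hia)).trans (hzi j hj)⟩
  obtain ⟨z, hxz, hz, hze, hzi⟩ := hchildren (Set.toFinite {a | P i a}).toFinset (by simp)
  have hupdate : PreservesEdges P R (Function.update z i c) :=
    hP.preservesEdges_update hz (fun j hj => by rw [hzi j (hP.lt hj).le]; exact hin j hj)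
      fun j hj => by rw [hze j (by simpa using hj)]; exact hR hec
  exact ⟨_, hxz.tail ⟨hz, hupdate, i, fun j hj => Function.update_of_ne hj c z⟩, hupdate,
    Function.update_self .., fun j hj => by rw [Function.update_of_ne hj.ne, hzi j hj.le]⟩

theorem exists_moves_apply_eq (hP : IsForwardForest P) (hR : ∀ ⦃a b⦄, R a b → R b a)
    (htwo : ∀ a b, ReflTransGen (fun a c => ∃ b, R a b ∧ R b c) a b) {x : ι → V} {i : ι} {c : V}
    (hx : PreservesEdges P R x) (hin : ∀ j, P j i → R (x j) c) :
    ∃ z, ReflTransGen (SingleSiteMove P R) x z ∧ PreservesEdges P R z ∧ z i = c ∧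
      ∀ j < i, z j = x j := by
  by_cases hroot : ∃ p, P p i
  · obtain ⟨p, hp⟩ := hroot
    exact hP.exists_moves_of_common_neighbor hR hx hin (hR (hx hp)) (hin p hp)
  · clear hin
    induction htwo (x i) c with
    | refl => exact ⟨x, .refl, hx, rfl, fun _ _ => rfl⟩
    | tail _ hbc ih =>
      obtain ⟨z, hxz, hz, rfl, hzx⟩ := ih
      obtain ⟨e, hbe, hec⟩ := hbc
      obtain ⟨z', hzz', hz', hz'i, hz'z⟩ := hP.exists_moves_of_common_neighbor hR hz
        (fun j hj => absurd ⟨j, hj⟩ hroot) hbe hec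
      exact ⟨z', hxz.trans hzz', hz', hz'i, fun j hj => (hz'z j hj).trans (hzx j hj)⟩

theorem reflTransGen_singleSiteMove (hP : IsForwardForest P) (hR : ∀ ⦃a b⦄, R a b → R b a)
    (htwo : ∀ a b, ReflTransGen (fun a c => ∃ b, R a b ∧ R b c) a b) {x y : ι → V}
    (hx : PreservesEdges P R x) (hy : PreservesEdges P R y) :
    ReflTransGen (SingleSiteMove P R) x y := by
  have : Fintype ι := Fintype.ofFinite ι
  suffices hagree : ∀ s : Finset ι, IsLowerSet (s : Set ι) →
      ∃ z, ReflTransGen (SingleSiteMove P R) x z ∧ PreservesEdges P R z ∧ ∀ j ∈ s, z j = y j by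
    obtain ⟨z, hxz, -, hzy⟩ := hagree Finset.univ (by simpa using isLowerSet_univ)
    rwa [funext fun j => hzy j (Finset.mem_univ j)] at hxz
  intro s
  induction s using Finset.induction_on_max with
  | empty => exact fun _ => ⟨x, .refl, hx, by simp⟩
  | insert a s hmax ih =>
    intro hlower
    have hmem : ∀ {j k}, j < k → k ∈ insert a s → j ∈ s := fun {j k} hjk hk =>
      Finset.mem_of_mem_insert_of_ne (hlower hjk.le hk) <| hjk.trans_le
        ((Finset.mem_insert.1 hk).elim le_of_eq fun hk => (hmax k hk).le) |>.ne
    obtain ⟨z, hxz, hz, hzy⟩ := ih fun k j hjk hk => hjk.eq_or_lt.elim (· ▸ hk) fun hlt =>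
      hmem hlt (Finset.mem_insert_of_mem hk)
    obtain ⟨z', hzz', hz', hz'a, hz'z⟩ := hP.exists_moves_apply_eq hR htwo hz (c := y a)
      fun j hj => by rw [hzy j (hmem (hP.lt hj) (Finset.mem_insert_self a s))]; exact hy hj
    refine ⟨z', hxz.trans hzz', hz', (Finset.forall_mem_insert ..).2 ⟨hz'a, fun j hj => ?_⟩⟩
    exact (hz'z j (hmax j hj)).trans (hzy j hj)

end IsForwardForest

end Reconfiguration

section Observables

variable {V : Type*} [Fintype V] {m : ℕ} {F : Motif m} {G : Network V} {x : Fin (m + 1) → V}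

theorem edgeProd_nonneg (F : Motif m) (G : Network V) (x : Fin (m + 1) → V) :
    0 ≤ edgeProd F G x :=
  Finset.prod_nonneg fun _ _ => Finset.prod_nonneg fun _ _ => Real.rpow_nonneg (G.A_nonneg _ _) _

theorem edgeProd_pos_iff : 0 < edgeProd F G x ↔ ∀ i j, 0 < F.A i j → 0 < G.A (x i) (x j) := by
  rw [(edgeProd_nonneg F G x).lt_iff_ne', edgeProd]
  simp only [Finset.prod_ne_zero_iff, Finset.mem_univ, true_imp_iff]
  refine forall₂_congr fun i j => ?_
  rw [Ne, Real.rpow_eq_zero_iff_of_nonneg (G.A_nonneg _ _), not_and',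
    (G.A_nonneg _ _).lt_iff_ne', (F.A_nonneg i j).lt_iff_ne']

theorem edgeProd_add (H F : Motif m) (G : Network V) (x : Fin (m + 1) → V) :
    edgeProd (H + F) G x = edgeProd H G x * edgeProd F G x := by
  simp only [edgeProd, ← Finset.prod_mul_distrib]
  refine Finset.prod_congr rfl fun i _ => Finset.prod_congr rfl fun j _ => ?_
  exact Real.rpow_add_of_nonneg (G.A_nonneg _ _) (H.A_nonneg _ _) (F.A_nonneg _ _)

theorem prod_α_pos (G : Network V) (x : Fin (m + 1) → V) : 0 < ∏ i, G.α (x i) :=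
  Finset.prod_pos fun _ _ => G.α_pos _

theorem edgeProd_mul_prod_α_nonneg (F : Motif m) (G : Network V) (x : Fin (m + 1) → V) :
    0 ≤ edgeProd F G x * ∏ i, G.α (x i) :=
  mul_nonneg (edgeProd_nonneg F G x) (prod_α_pos G x).le

theorem homDensity_nonneg (F : Motif m) (G : Network V) : 0 ≤ homDensity F G :=
  Finset.sum_nonneg fun x _ => edgeProd_mul_prod_α_nonneg F G x

theorem homProb_nonneg (F : Motif m) (G : Network V) (x : Fin (m + 1) → V) :
    0 ≤ homProb F G x :=
  div_nonneg (edgeProd_mul_prod_α_nonneg F G x) (homDensity_nonneg F G)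

theorem IsHom.homDensity_pos (hx : IsHom F G x) : 0 < homDensity F G :=
  (homDensity_nonneg F G).lt_of_ne' (div_ne_zero_iff.1 hx.ne').2

theorem isHom_iff (h : 0 < homDensity F G) :
    IsHom F G x ↔ PreservesEdges (fun i j => 0 < F.A i j) (fun a b => 0 < G.A a b) x := by
  rw [IsHom, homProb, div_pos_iff_of_pos_right h, mul_pos_iff_of_pos_right (prod_α_pos _ _),
    edgeProd_pos_iff, PreservesEdges]

theorem homProb_mem_stdSimplex (h : 0 < homDensity F G) :
    homProb F G ∈ stdSimplex ℝ (Fin (m + 1) → V) :=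
  ⟨homProb_nonneg F G, (Finset.sum_div _ _ _).symm.trans (div_self h.ne')⟩

theorem homProb_dotProduct_edgeProd (H F : Motif m) (G : Network V) :
    homProb F G ⬝ᵥ edgeProd H G = condHomDensity H G F := by
  rw [condHomDensity, homDensity, Finset.sum_div]
  refine Finset.sum_congr rfl fun x _ => ?_
  rw [homProb, edgeProd_add]
  ring

theorem homProb_mul_edgeProd (H F : Motif m) (G : Network V) (x : Fin (m + 1) → V) :
    homProb F G x * edgeProd H G x = condHomDensity H G F * homProb (H + F) G x := by
  have hadd : homProb F G x * edgeProd H G x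
      = edgeProd (H + F) G x * (∏ i, G.α (x i)) / homDensity F G := by
    rw [homProb, edgeProd_add]
    ring
  rw [hadd, condHomDensity, homProb]
  rcases eq_or_ne (homDensity (H + F) G) 0 with h | h
  · rw [h, zero_div, zero_mul, (Finset.sum_eq_zero_iff_of_nonneg fun x _ =>
      edgeProd_mul_prod_α_nonneg (H + F) G x).1 h x (Finset.mem_univ x), zero_div]
  · field_simp

theorem homProbOf_eq_dotProduct (F : Motif m) (G : Network V) (E : Set (Fin (m + 1) → V)) :
    homProbOf F G E = homProb F G ⬝ᵥ E.indicator 1 := by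
  refine Finset.sum_congr rfl fun x _ => ?_
  simp only [← Set.indicator_mul_right, Pi.one_apply, mul_one]

theorem prod_ite_le_eq_indicator (H : Motif m) (G : Network V) (s : ℝ) (x : Fin (m + 1) → V) :
    (∏ i, ∏ j, if s ≤ G.A (x i) (x j) ^ H.A i j then (1 : ℝ) else 0)
      = {x | s ≤ Finset.univ.inf' Finset.univ_nonempty (fun p : Fin (m + 1) × Fin (m + 1) =>
          G.A (x p.1) (x p.2) ^ H.A p.1 p.2)}.indicator 1 x := by
  classical
  rw [Set.indicator_apply]
  simp only [Finset.prod_ite_zero, Finset.prod_const_one, Finset.mem_univ, true_imp_iff,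
    Set.mem_ofPred_eq, Finset.le_inf'_iff, Prod.forall, Pi.one_apply]

theorem homProb_dotProduct_edgeProd_mul_indicator (H F : Motif m) (G : Network V)
    (E : Set (Fin (m + 1) → V)) :
    (homProb F G ⬝ᵥ fun x => edgeProd H G x * E.indicator 1 x)
      = condHomDensity H G F * homProbOf (H + F) G E := by
  rw [homProbOf_eq_dotProduct, dotProduct, dotProduct, Finset.mul_sum]
  refine Finset.sum_congr rfl fun x _ => ?_
  rw [← mul_assoc, homProb_mul_edgeProd, mul_assoc]

theorem timeAveragesConverge_of_tendsto [DecidableEq V] (H : Motif m) {x : ℕ → Fin (m + 1) → V}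
    (hx : ∀ f : (Fin (m + 1) → V) → ℝ, Tendsto
      (fun N : ℕ => (1 / (N : ℝ)) * ∑ t ∈ Finset.Icc 1 N, f (x t)) atTop
      (𝓝 (homProb F G ⬝ᵥ f))) :
    TimeAveragesConverge F H G x := by
  refine ⟨?_, fun s _ => ?_, ?_⟩
  · rw [← homProb_dotProduct_edgeProd]
    exact hx _
  · simp only [prod_ite_le_eq_indicator]
    rw [chdProfile, homProbOf_eq_dotProduct]
    exact hx _
  · refine tendsto_pi_nhds.2 fun a => tendsto_pi_nhds.2 fun b => ?_
    have hlim := hx fun x => edgeProd H G x * {x | x 0 = a ∧ x (Fin.last m) = b}.indicator 1 x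
    rw [homProb_dotProduct_edgeProd_mul_indicator] at hlim
    refine hlim.congr fun N => ?_
    simp only [Matrix.smul_apply, Matrix.sum_apply, smul_eq_mul, Matrix.single_apply,
      Set.indicator_apply, Set.mem_ofPred_eq, Pi.one_apply]

end Observables

section WalkKernel

variable {V : Type*} [Fintype V] {G : Network V}

theorem edgeFlow_nonneg (G : Network V) (a b : V) :
    0 ≤ G.α a * max (G.A a b) (G.A b a) * G.α b :=
  mul_nonneg (mul_nonneg (G.α_pos a).le (le_max_of_le_left (G.A_nonneg a b))) (G.α_pos b).le

theorem walkKernel_nonneg (G : Network V) (a b : V) : 0 ≤ walkKernel G a b :=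
  div_nonneg (edgeFlow_nonneg G a b) (Finset.sum_nonneg fun c _ => edgeFlow_nonneg G a c)

theorem walkKernel_pos_iff {a b : V} : 0 < walkKernel G a b ↔ 0 < G.A a b ∨ 0 < G.A b a := by
  have hle : G.α a * max (G.A a b) (G.A b a) * G.α b
      ≤ ∑ c, G.α a * max (G.A a c) (G.A c a) * G.α c :=
    Finset.single_le_sum (fun c _ => edgeFlow_nonneg G a c) (Finset.mem_univ b)
  have hiff : 0 < G.α a * max (G.A a b) (G.A b a) * G.α b ↔ 0 < max (G.A a b) (G.A b a) := by
    rw [mul_pos_iff_of_pos_right (G.α_pos b), mul_pos_iff_of_pos_left (G.α_pos a)]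
  rw [← lt_max_iff, ← hiff]
  refine ⟨fun h => ?_, fun h => div_pos h (h.trans_le hle)⟩
  exact (edgeFlow_nonneg G a b).lt_of_ne' (div_ne_zero_iff.1 h.ne').1

theorem sum_walkKernel (hout : G.HasOutEdges) (a : V) : ∑ b, walkKernel G a b = 1 := by
  obtain ⟨b, hb⟩ := hout a
  have hpos : 0 < walkKernel G a b := walkKernel_pos_iff.2 (.inl hb)
  exact (Finset.sum_div _ _ _).symm.trans (div_self (div_ne_zero_iff.1 hpos.ne').2)

theorem Network.IsIrreducible.reflTransGen [DecidableEq V] (hG : G.IsIrreducible) (a b : V) :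
    Relation.ReflTransGen (fun a b => 0 < walkKernel G a b) a b :=
  (hG a b).elim fun _ => reflTransGen_of_pow_pos (walkKernel_nonneg G)

theorem Network.IsBidirectional.skeleton_preconnected [DecidableEq V] (hbi : G.IsBidirectional)
    (hG : G.IsIrreducible) : G.skeleton.Preconnected := by
  intro a b
  induction hG.reflTransGen a b with
  | refl => exact .refl a
  | @tail c d _ hcd ih =>
    rcases eq_or_ne c d with rfl | hne
    · exact ih
    · have hA : 0 < G.A c d := (walkKernel_pos_iff.1 hcd).elim id (hbi d c).1
      exact ih.trans (SimpleGraph.Adj.reachable ⟨hne, lt_min hA ((hbi c d).1 hA)⟩)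

end WalkKernel

/-- A relaxation of `Motif.IsRootedTree` in which any node may lack an in-neighbour: the edges of
`F` respect the order of the nodes, and every node has at most one in-neighbour. -/
def Motif.IsRootedForest {m : ℕ} (F : Motif m) : Prop :=
  IsForwardForest fun i j => 0 < F.A i j

theorem Motif.IsRootedTree.isRootedForest {m : ℕ} {F : Motif m} (hF : F.IsRootedTree) :
    F.IsRootedForest := by
  have hne : ∀ {i j}, 0 < F.A i j → j ≠ 0 := fun {i j} hij hj => by
    rw [hj, hF.1 i] at hij
    exact lt_irrefl _ hij
  refine ⟨fun i j hij => ?_, fun i i' j hij hi'j => ?_⟩ <;>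
    obtain ⟨p, hlt, -, hp⟩ := hF.2 j (hne hij)
  · rwa [hp i hij]
  · rw [hp i hij, hp i' hi'j]

section PivotChain

variable {V : Type*} [Fintype V] {m : ℕ} {F : Motif m} {G : Network V}

theorem indicator_homProb_nonneg (F : Motif m) (G : Network V) (E : Set (Fin (m + 1) → V))
    (x : Fin (m + 1) → V) : 0 ≤ E.indicator (homProb F G) x :=
  Set.indicator_nonneg (fun x _ => homProb_nonneg F G x) x

theorem homProbOf_nonneg (F : Motif m) (G : Network V) (E : Set (Fin (m + 1) → V)) :
    0 ≤ homProbOf F G E :=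
  Finset.sum_nonneg fun x _ => indicator_homProb_nonneg F G E x

theorem homProbOf_mono {E E' : Set (Fin (m + 1) → V)} (h : E ⊆ E') :
    homProbOf F G E ≤ homProbOf F G E' :=
  Finset.sum_le_sum fun x _ => Set.indicator_le_indicator_of_subset h (homProb_nonneg F G) x

theorem homProbOf_singleton (F : Motif m) (G : Network V) (y : Fin (m + 1) → V) :
    homProbOf F G {y} = homProb F G y := by
  classical
  simp [homProbOf, Set.indicator_apply]

theorem sum_fiber_homProb [DecidableEq V] (F : Motif m) (G : Network V) (a : V) :
    ∑ x with x 0 = a, homProb F G x = pivotMarginal F G a := by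
  rw [Finset.sum_filter]
  refine Finset.sum_congr rfl fun x _ => ?_
  simp only [Set.indicator_apply, Set.mem_ofPred_eq]

theorem sum_pivotMarginal (h : 0 < homDensity F G) : ∑ a, pivotMarginal F G a = 1 := by
  classical
  simp only [← sum_fiber_homProb]
  exact (Finset.sum_fiberwise _ _ _).trans (homProb_mem_stdSimplex h).2

theorem Motif.IsRootedForest.pivotMarginal_pos (hF : F.IsRootedForest) (hout : G.HasOutEdges)
    (hpos : 0 < homDensity F G) (a : V) : 0 < pivotMarginal F G a := by
  obtain ⟨x, hx, hroot⟩ := IsForwardForest.exists_preservesEdges hF hout a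
  have hx0 : x 0 = a := hroot 0 fun j hj => (hF.lt hj).not_ge (Fin.zero_le j)
  refine Finset.sum_pos' (fun y _ => indicator_homProb_nonneg F G _ y) ⟨x, Finset.mem_univ x, ?_⟩
  rw [Set.indicator_of_mem (show x ∈ {z : Fin (m + 1) → V | z 0 = a} from hx0)]
  exact (isHom_iff hpos).2 hx

theorem prod_nextNodeProb {y : Fin (m + 1) → V} (hy : pivotMarginal F G (y 0) ≠ 0) :
    ∏ i ∈ Finset.univ.erase 0, nextNodeProb F G i y
      = homProb F G y / pivotMarginal F G (y 0) := by
  let E : ℕ → Set (Fin (m + 1) → V) := fun n => {z | ∀ j : Fin (m + 1), (j : ℕ) ≤ n → z j = y j}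
  have hzero : E 0 = {z | z 0 = y 0} := by
    ext z
    simp [E]
  have hlast : E m = {y} := by
    ext z
    simp [E, funext_iff, Fin.is_le]
  have hnext : ∀ i : Fin m,
      nextNodeProb F G i.succ y = homProbOf F G (E (i + 1)) / homProbOf F G (E i) := fun i => by
    simp only [nextNodeProb, E, Fin.le_def, Fin.lt_def, Fin.val_succ, Nat.lt_succ_iff]
  have hvanish : ∀ n, homProbOf F G (E n) = 0 → homProbOf F G (E (n + 1)) = 0 := fun n hn =>
    (homProbOf_nonneg F G _).antisymm' <|
      hn ▸ homProbOf_mono fun z hz j hj => hz j (Nat.le_succ_of_le hj)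
  have htelescope := prod_range_div_eq_div (q := fun n => homProbOf F G (E n))
    (by rwa [hzero]) hvanish m
  rw [hzero, hlast, homProbOf_singleton, Finset.prod_range] at htelescope
  rw [pivotMarginal, ← htelescope, ← Finset.prod_congr rfl fun i _ => hnext i,
    Finset.erase_eq, ← Finset.compl_eq_univ_sdiff, ← Fin.image_succ_univ,
    Finset.prod_image (Fin.succ_injective m).injOn]

variable [DecidableEq V]

theorem pivotKernel_eq_liftKernel (hpos : ∀ a, 0 < pivotMarginal F G a) :
    pivotKernel F G = liftKernel (metropolisKernel (walkKernel G) (pivotMarginal F G))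
      (pivotMarginal F G) (fun x => x 0) (homProb F G) := by
  ext x y
  rw [pivotKernel, prod_nextNodeProb (hpos _).ne']
  rfl

theorem isErgodicKernel_pivotKernel (hF : F.IsRootedForest) (hG : G.IsIrreducible)
    (hout : G.HasOutEdges) (hpos : 0 < homDensity F G) :
    IsErgodicKernel (pivotKernel F G) (homProb F G) := by
  have hmarginal := hF.pivotMarginal_pos hout hpos
  rw [pivotKernel_eq_liftKernel hmarginal]
  refine IsErgodicKernel.liftKernel ?_ (homProb_nonneg F G) (sum_fiber_homProb F G)
  exact isErgodicKernel_metropolisKernel (walkKernel_nonneg G) (sum_walkKernel hout)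
    (fun _ _ h => walkKernel_pos_iff.2 (walkKernel_pos_iff.1 h).symm) hG.reflTransGen hmarginal
    (sum_pivotMarginal hpos)

end PivotChain

section GlauberChain

theorem prod_prod_eq_erase {ι M : Type*} [Fintype ι] [DecidableEq ι] [CommMonoid M]
    (f : ι → ι → M) (i : ι) :
    ∏ a, ∏ b, f a b = (∏ a ∈ Finset.univ.erase i, ∏ b ∈ Finset.univ.erase i, f a b) *
      ((∏ j ∈ Finset.univ.erase i, f j i * f i j) * f i i) := by
  have h : ∀ a, ∏ b, f a b = f a i * ∏ b ∈ Finset.univ.erase i, f a b := fun a =>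
    (Finset.mul_prod_erase _ _ (Finset.mem_univ i)).symm
  rw [← Finset.mul_prod_erase _ _ (Finset.mem_univ i)]
  simp only [h, Finset.prod_mul_distrib]
  ac_rfl

variable {V : Type*} [Fintype V] {m : ℕ} {F : Motif m} {G : Network V}

theorem exists_homProb_update_eq_mul_glauberWeight (F : Motif m) (G : Network V)
    (x : Fin (m + 1) → V) (i : Fin (m + 1)) :
    ∃ r : ℝ, ∀ b, homProb F G (Function.update x i b) = r * glauberWeight F G x i b := by
  refine ⟨(∏ a ∈ Finset.univ.erase i, ∏ b ∈ Finset.univ.erase i, G.A (x a) (x b) ^ F.A a b) *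
    (∏ a ∈ Finset.univ.erase i, G.α (x a)) / homDensity F G, fun b => ?_⟩
  have hoff : ∀ j ∈ Finset.univ.erase i, Function.update x i b j = x j := fun j hj =>
    Function.update_of_ne (Finset.ne_of_mem_erase hj) _ _
  have hrest : ∏ j ∈ Finset.univ.erase i, ∏ l ∈ Finset.univ.erase i,
        G.A (Function.update x i b j) (Function.update x i b l) ^ F.A j l
      = ∏ j ∈ Finset.univ.erase i, ∏ l ∈ Finset.univ.erase i, G.A (x j) (x l) ^ F.A j l :=
    Finset.prod_congr rfl fun j hj => Finset.prod_congr rfl fun l hl => by rw [hoff j hj, hoff l hl]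
  have hedges : ∏ j ∈ Finset.univ.erase i,
        G.A (Function.update x i b j) b ^ F.A j i * G.A b (Function.update x i b j) ^ F.A i j
      = ∏ j ∈ Finset.univ.erase i, G.A (x j) b ^ F.A j i * G.A b (x j) ^ F.A i j :=
    Finset.prod_congr rfl fun j hj => by rw [hoff j hj]
  have hα : ∏ j, G.α (Function.update x i b j)
      = G.α b * ∏ j ∈ Finset.univ.erase i, G.α (x j) := by
    rw [← Finset.mul_prod_erase _ _ (Finset.mem_univ i), Function.update_self]
    exact congrArg _ (Finset.prod_congr rfl fun j hj => by rw [hoff j hj])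
  rw [homProb, edgeProd, prod_prod_eq_erase _ i, hα, Function.update_self, hrest, hedges,
    glauberWeight]
  ring

variable [DecidableEq V]

theorem glauberKernel_eq_heatBathKernel {x : Fin (m + 1) → V} (hx : IsHom F G x) :
    glauberKernel F G x = heatBathKernel (homProb F G) x := by
  ext y
  rw [glauberKernel, heatBathKernel, Fintype.card_fin, Nat.cast_add, Nat.cast_one]
  refine Finset.sum_congr rfl fun i _ => congrArg _ ?_
  by_cases hxy : ∀ j, j ≠ i → y j = x j
  · obtain ⟨r, hr⟩ := exists_homProb_update_eq_mul_glauberWeight F G x i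
    have hr0 : r ≠ 0 := by
      have hxr : homProb F G x = r * glauberWeight F G x i (x i) := by
        rw [← hr, Function.update_eq_self]
      exact left_ne_zero_of_mul (hxr ▸ hx.ne')
    rw [if_pos hxy, if_pos hxy, Function.eq_update_iff.2 ⟨rfl, hxy⟩]
    simp only [hr, Function.update_self]
    rw [← Finset.mul_sum, mul_div_mul_left _ _ hr0]
  · rw [if_neg hxy, if_neg hxy]

theorem isErgodicKernel_glauberKernel (hF : F.IsRootedForest) (hG : G.IsIrreducible)
    (hbi : G.IsBidirectional)
    (hodd : ∃ (v : V) (c : G.skeleton.Walk v v), c.IsCycle ∧ Odd c.length)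
    (hpos : 0 < homDensity F G) : IsErgodicKernel (glauberKernel F G) (homProb F G) := by
  obtain ⟨v, c, -, hc⟩ := hodd
  have htwo : ∀ a b, Relation.ReflTransGen (fun a c => ∃ b, 0 < G.A a b ∧ 0 < G.A b c) a b :=
    fun a b => by
      obtain ⟨p, hp⟩ := exists_even_walk_of_odd_closed_walk (hbi.skeleton_preconnected hG) c hc a b
      refine Relation.ReflTransGen.mono ?_ a b (reflTransGen_two_step_of_even_walk p hp)
      exact fun a c ⟨b, hab, hbc⟩ => ⟨b, (lt_min_iff.1 hab.2).1, (lt_min_iff.1 hbc.2).1⟩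
  refine (isErgodicKernel_heatBathKernel (homProb_mem_stdSimplex hpos) fun x y hx hy => ?_).congr
    fun x hx => glauberKernel_eq_heatBathKernel hx
  refine Relation.ReflTransGen.mono ?_ x y (IsForwardForest.reflTransGen_singleSiteMove hF
    (fun a b => (hbi a b).1) htwo ((isHom_iff hpos).1 hx) ((isHom_iff hpos).1 hy))
  exact fun z w ⟨hz, hw, hzw⟩ => ⟨(isHom_iff hpos).2 hz, (isHom_iff hpos).2 hw, hzw⟩

end GlauberChain

end MotifSampling

theorem mainTheorem9_general {V : Type*} [Fintype V] [DecidableEq V] {m : ℕ}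
    (F H : Motif m) (hF : F.IsRootedForest)
    (G : Network V) (hG : G.IsIrreducible)
    (x₀ : Fin (m + 1) → V) (hx₀ : IsHom F G x₀)
    {Ω : Type*} [MeasurableSpace Ω] (μ : Measure Ω) [IsProbabilityMeasure μ]
    (X : ℕ → Ω → Fin (m + 1) → V) :
    (G.HasOutEdges → IsMarkovChain μ (pivotKernel F G) x₀ X →
      ∀ᵐ ω ∂μ, TimeAveragesConverge F H G (fun t => X t ω)) ∧
    (G.IsBidirectional → (∃ (v : V) (c : G.skeleton.Walk v v), c.IsCycle ∧ Odd c.length) →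
      IsMarkovChain μ (glauberKernel F G) x₀ X →
      ∀ᵐ ω ∂μ, TimeAveragesConverge F H G (fun t => X t ω)) := by
  have hconv : ∀ {K}, IsErgodicKernel K (homProb F G) → IsMarkovChain μ K x₀ X →
      ∀ᵐ ω ∂μ, TimeAveragesConverge F H G (fun t => X t ω) := fun hK hX =>
    (hX.ae_forall_tendsto_average hK hx₀).mono fun _ => timeAveragesConverge_of_tendsto H
  exact ⟨fun hout => hconv (isErgodicKernel_pivotKernel hF hG hout hx₀.homDensity_pos),
    fun hbi hodd => hconv (isErgodicKernel_glauberKernel hF hG hbi hodd hx₀.homDensity_pos)⟩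

theorem mainTheorem9 {V : Type*} [Fintype V] [DecidableEq V] {m : ℕ}
    (F H : Motif m) (hF : F.IsRootedTree)
    (G : Network V) (hG : G.IsIrreducible)
    (x₀ : Fin (m + 1) → V) (hx₀ : IsHom F G x₀)
    {Ω : Type*} [MeasurableSpace Ω] (μ : Measure Ω) [IsProbabilityMeasure μ]
    (X : ℕ → Ω → Fin (m + 1) → V) :
    (G.HasOutEdges → IsMarkovChain μ (pivotKernel F G) x₀ X →
      ∀ᵐ ω ∂μ, TimeAveragesConverge F H G (fun t => X t ω)) ∧
    (G.IsBidirectional → (∃ (v : V) (c : G.skeleton.Walk v v), c.IsCycle ∧ Odd c.length) →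
      IsMarkovChain μ (glauberKernel F G) x₀ X →
      ∀ᵐ ω ∂μ, TimeAveragesConverge F H G (fun t => X t ω)) :=
  mainTheorem9_general F H hF.isRootedForest G hG x₀ hx₀ μ X
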